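/- Let $k$ be a commutative artinian ring, let $J$ be an injective envelope of the $k$-module $k/\operatorname{rad}k$ (so $J\cong k$ if $k$ is a field), and put $D=\operatorname{Hom}_k(-,J)$. Let $(\mathcal C,\mathbb E,\mathfrak s)$ be a $k$-linear extriangulated category (in the sense of Nakaoka and Palu; $\mathcal C$ is a $k$-linear additive category and $\mathbb E:\mathcal C^{\mathrm{op}}\times\mathcal C\to \operatorname{Mod}k$ is $k$-bilinear). An object $P$ is projective if $\mathcal C(P,y)$ is surjective for every $\mathfrak s$-deflation $y$, and an object $I$ is injective if $\mathcal C(x,I)$ is surjective for every $\mathfrak s$-inflation $x$; let $\mathcal P$ and $\mathcal I$ be the full subcategories of projective and of injective objects. For an $\mathfrak s$-triangle $\delta=(X_1\xrightarrow{f_1}X_2\xrightarrow{f_2}X_3\dashrightarrow)$ define its contravariant defect $\delta^*$ and its covariant defect $\delta_*$ by the exact sequences $$\mathcal C(-,X_1)\to\mathcal C(-,X_2)\to\mathcal C(-,X_3)\to\delta^*\to0,\qquad \mathcal C(X_3,-)\to\mathcal C(X_2,-)\to\mathcal C(X_1,-)\to\delta_*\to0;$$ $\delta^*$ is a right module over the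 ideal quotient $\mathcal C/[\mathcal P]$, and $\delta_*$ is a left module over $\mathcal C/[\mathcal I]$. A dualizing $k$-variety is a Hom-finite $k$-linear additive category $\mathcal A$ with split idempotents such that $D$ (applied pointwise) restricts to a duality between the finitely presented right and the finitely presented left $\mathcal A$-modules. Assume that $\mathcal C$ is Ext-finite (each $\mathbb E(X,Y)$ is a finitely generated $k$-module) and has enough projectives and enough injectives, that idempotents split in $\mathcal C/[\mathcal P]$ and in $\mathcal C/[\mathcal I]$, and that at least one of $\mathcal C/[\mathcal P]$, $\mathcal C/[\mathcal I]$ is a dualizing $k$-variety. Then there is an equivalence $\tau:\mathcal C/[\mathcal P]\to\mathcal C/[\mathcal I]$, with quasi-inverse $\tau^{-1}$, such that: (1) $D\mathbb E(-,X)\cong\mathcal C/[\mathcal P](\tau^{-1}X,-)$ and $D\mathbb E(X,-)\cong\mathcal C/[\mathcal I](-,\tau X)$ as functors on $\mathcal C$ for every object $X$ of $\mathcal C$, naturally in $X$; (2) $D\delta_*\cong\delta^*\tau^{-1}$ as right $\mathcal C/[\mathcal I]$-modules and $D\delta^*\cong\delta_*\tau$ as left $\mathcal C/[\mathcal P]$-modules,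 for every $\mathfrak s$-triangle $\delta$. -/

import Mathlib

open CategoryTheory CategoryTheory.Limits Opposite

open scoped ZeroObject

universe w v u

namespace ARDuality

noncomputable section

/-! ### The duality `D = Hom_k(-, J)` -/

/-- `J` is an injective envelope of the `k`-module `k / rad k`: it is injective and contains
`k / rad k` as an essential submodule. (If `k` is a field, this says that `J ≅ k`.) -/
structure IsInjectiveEnvelopeOfTop (k : Type w) [CommRing k] (J : Type v) [AddCommGroup J]
    [Module k J] : Prop where
  injective : Module.Injective k J
  exists_essential : ∃ i : (k ⧸ (⊥ : Ideal k).jacobson) →ₗ[k] J,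
    Function.Injective i ∧ ∀ N : Submodule k J, N ⊓ LinearMap.range i = ⊥ → N = ⊥

/-- The contravariant functor `D = Hom_k(-, J)` on `k`-modules. -/
def dual (k : Type w) [CommRing k] (J : Type v) [AddCommGroup J] [Module k J] :
    (ModuleCat.{v} k)ᵒᵖ ⥤ ModuleCat.{v} k where
  obj M := ModuleCat.of k (M.unop →ₗ[k] J)
  map f := ModuleCat.ofHom (LinearMap.lcomp k J f.unop.hom)

/-- For a left module `F : A ⥤ Mod k`, the right module `D F`, `Z ↦ D (F Z)`. -/
def dualOfLeft {k : Type w} [CommRing k] (J : Type v) [AddCommGroup J] [Module k J]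
    {A : Type u} [Category.{v} A] (F : A ⥤ ModuleCat.{v} k) : Aᵒᵖ ⥤ ModuleCat.{v} k :=
  F.op ⋙ dual k J

/-- For a right module `F : Aᵒᵖ ⥤ Mod k`, the left module `D F`, `Z ↦ D (F Z)`. -/
def dualOfRight {k : Type w} [CommRing k] (J : Type v) [AddCommGroup J] [Module k J]
    {A : Type u} [Category.{v} A] (F : Aᵒᵖ ⥤ ModuleCat.{v} k) : A ⥤ ModuleCat.{v} k :=
  F.rightOp ⋙ dual k J

/-! ### Finitely presented modules and dualizing `k`-varieties -/

section Variety

variable (k : Type w) [CommRing k] (A : Type u) [Category.{v} A] [Preadditive A] [Linear k A]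

/-- A right `A`-module `F` is finitely presented if there is an exact sequence
`A(-, X) ⟶ A(-, Y) ⟶ F ⟶ 0`. -/
def IsFinPresRight (F : Aᵒᵖ ⥤ ModuleCat.{v} k) : Prop :=
  ∃ (X Y : A) (f : X ⟶ Y), Nonempty (F ≅ cokernel ((linearYoneda k A).map f))

/-- A left `A`-module `F` is finitely presented if there is an exact sequence
`A(Y, -) ⟶ A(X, -) ⟶ F ⟶ 0`. -/
def IsFinPresLeft (F : A ⥤ ModuleCat.{v} k) : Prop :=
  ∃ (X Y : A) (f : X ⟶ Y), Nonempty (F ≅ cokernel ((linearCoyoneda k A).map f.op))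

/-- A dualizing `k`-variety: a Hom-finite `k`-linear additive category with split idempotents such
that `D` restricts to a duality between the finitely presented right and left modules. Hom-finiteness
makes all values of finitely presented modules finite over `k`, so that `D D ≅ id` on them and a
duality is obtained as soon as `D` preserves finite presentation in both directions. -/
structure IsDualizingVariety (J : Type v) [AddCommGroup J] [Module k J] : Prop where
  hasFiniteBiproducts : HasFiniteBiproducts A
  isIdempotentComplete : IsIdempotentComplete A
  homFinite : ∀ X Y : A, Module.Finite k (X ⟶ Y)
  dual_right : ∀ F : Aᵒᵖ ⥤ ModuleCat.{v} k,
    IsFinPresRight k A F → IsFinPresLeft k A (dualOfRight J F)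
  dual_left : ∀ F : A ⥤ ModuleCat.{v} k,
    IsFinPresLeft k A F → IsFinPresRight k A (dualOfLeft J F)

end Variety

/-! ### Ideal quotients -/

section IdealQuotient

variable {C : Type u} [Category.{v} C] [Preadditive C] [HasBinaryBiproducts C]

/-- `Q` contains a zero object and is closed under binary direct sums. -/
class IsAdditiveClosed (Q : ObjectProperty C) : Prop where
  exists_zero : ∃ Z : C, IsZero Z ∧ Q Z
  biprod : ∀ X Y : C, Q X → Q Y → Q (X ⊞ Y)

/-- `f` and `g` are congruent modulo the ideal `[Q]` of the morphisms that factor through an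
object of `Q`. -/
def idealRel (Q : ObjectProperty C) : HomRel C := fun X Y f g =>
  ∃ (P : C) (_ : Q P) (a : X ⟶ P) (b : P ⟶ Y), a ≫ b = f - g

variable (Q : ObjectProperty C) [IsAdditiveClosed Q]

theorem idealRel_add {X Y : C} (f₁ f₂ g₁ g₂ : X ⟶ Y) (hf : idealRel Q f₁ f₂)
    (hg : idealRel Q g₁ g₂) : idealRel Q (f₁ + g₁) (f₂ + g₂) := by
  obtain ⟨P, hP, a, b, h⟩ := hf
  obtain ⟨P', hP', a', b', h'⟩ := hg
  refine ⟨P ⊞ P', IsAdditiveClosed.biprod _ _ hP hP', biprod.lift a a', biprod.desc b b', ?_⟩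
  rw [biprod.lift_desc, h, h']
  abel

instance idealRel_congruence : Congruence (idealRel Q) where
  equivalence := by
    intro X Y
    refine ⟨fun f => ?_, ?_, ?_⟩
    · obtain ⟨Z, -, hZ⟩ := IsAdditiveClosed.exists_zero (Q := Q)
      exact ⟨Z, hZ, 0, 0, by simp⟩
    · rintro f g ⟨P, hP, a, b, h⟩
      exact ⟨P, hP, -a, b, by rw [Preadditive.neg_comp, h, neg_sub]⟩
    · intro f g h h₁ h₂
      obtain ⟨P, hP, a, b, e⟩ := idealRel_add Q _ _ _ _ h₁ h₂
      exact ⟨P, hP, a, b, by rw [e]; abel⟩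
  comp_left := by
    rintro X Y Z f g g' ⟨P, hP, a, b, h⟩
    exact ⟨P, hP, f ≫ a, b, by rw [Category.assoc, h, Preadditive.comp_sub]⟩
  comp_right := by
    rintro X Y Z f f' g ⟨P, hP, a, b, h⟩
    exact ⟨P, hP, a, b ≫ g, by rw [← Category.assoc, h, Preadditive.sub_comp]⟩

/-- The ideal quotient `C/[Q]`. -/
abbrev IdealQuotient := CategoryTheory.Quotient (idealRel Q)

instance idealQuotientPreadditive : Preadditive (IdealQuotient Q) :=
  Quotient.preadditive _ (fun _ _ => idealRel_add Q)

instance idealQuotientFunctorAdditive : (Quotient.functor (idealRel Q)).Additive :=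
  Quotient.functor_additive _ (fun _ _ => idealRel_add Q)

instance idealQuotientLinear (k : Type w) [CommRing k] [Linear k C] :
    Linear k (IdealQuotient Q) :=
  Quotient.linear k (idealRel Q) (by
    rintro r X Y f g ⟨P, hP, a, b, h⟩
    exact ⟨P, hP, r • a, b, by rw [Linear.smul_comp, h, smul_sub]⟩)

end IdealQuotient

/-! ### Extriangulated categories -/

/-- A `k`-linear extriangulated structure on the additive `k`-linear category `C`.
The bifunctor is `E : Cᵒᵖ × C ⟶ Mod k`; an extension of `X` by `A` is `δ ∈ E(X, A)`.
The realization `𝔰` is given by the relation `IsTriangle x y δ`, "`A ⟶ B ⟶ X` belongs to the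
class `𝔰(δ)`"; the fields `exists_triangle`, `triangle_of_iso` and `iso_of_triangle` say that for
each `δ` the sequences in relation with it form exactly one equivalence class. -/
structure Extriangulated (k : Type w) [CommRing k] (C : Type u) [Category.{v} C] [Preadditive C]
    [Linear k C] [HasBinaryBiproducts C] where
  /-- the bifunctor of extensions -/
  E : Cᵒᵖ ⥤ C ⥤ ModuleCat.{v} k
  additive_left : E.Additive
  linear_left : ∀ {X Y : C} (r : k) (c : X ⟶ Y) (A : C),
    (E.map (r • c).op).app A = r • (E.map c.op).app A
  additive_right : ∀ X, (E.obj X).Additive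
  linear_right : ∀ X, (E.obj X).Linear k
  /-- `A ⟶ B ⟶ X` realizes `δ` -/
  IsTriangle : ∀ {A B X : C}, (A ⟶ B) → (B ⟶ X) → (E.obj (op X)).obj A → Prop
  exists_triangle : ∀ {A X : C} (δ : (E.obj (op X)).obj A),
    ∃ (B : C) (x : A ⟶ B) (y : B ⟶ X), IsTriangle x y δ
  triangle_of_iso : ∀ {A B B' X : C} {x : A ⟶ B} {y : B ⟶ X} {x' : A ⟶ B'} {y' : B' ⟶ X}
    {δ : (E.obj (op X)).obj A} (b : B ≅ B'), x ≫ b.hom = x' → b.hom ≫ y' = y →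
    IsTriangle x y δ → IsTriangle x' y' δ
  iso_of_triangle : ∀ {A B B' X : C} {x : A ⟶ B} {y : B ⟶ X} {x' : A ⟶ B'} {y' : B' ⟶ X}
    {δ : (E.obj (op X)).obj A}, IsTriangle x y δ → IsTriangle x' y' δ →
    ∃ b : B ≅ B', x ≫ b.hom = x' ∧ b.hom ≫ y' = y
  /-- morphisms `(a, c)` of extensions are realized -/
  realize_hom : ∀ {A B X A' B' X' : C} {x : A ⟶ B} {y : B ⟶ X} {δ : (E.obj (op X)).obj A}
    {x' : A' ⟶ B'} {y' : B' ⟶ X'} {δ' : (E.obj (op X')).obj A'},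
    IsTriangle x y δ → IsTriangle x' y' δ' → ∀ (a : A ⟶ A') (c : X ⟶ X'),
    (E.obj (op X)).map a δ = (E.map c.op).app A' δ' →
    ∃ b : B ⟶ B', x ≫ b = a ≫ x' ∧ y ≫ c = b ≫ y'
  /-- `𝔰(0)` is the class of the split sequence -/
  triangle_zero : ∀ A X : C,
    IsTriangle (biprod.inl : A ⟶ A ⊞ X) biprod.snd (0 : (E.obj (op X)).obj A)
  /-- `𝔰(δ ⊕ δ') = 𝔰(δ) ⊕ 𝔰(δ')` -/
  triangle_biprod : ∀ {A B X A' B' X' : C} {x : A ⟶ B} {y : B ⟶ X} {δ : (E.obj (op X)).obj A}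
    {x' : A' ⟶ B'} {y' : B' ⟶ X'} {δ' : (E.obj (op X')).obj A'},
    IsTriangle x y δ → IsTriangle x' y' δ' →
    IsTriangle (biprod.map x x') (biprod.map y y')
      ((E.map (biprod.fst : X ⊞ X' ⟶ X).op).app (A ⊞ A')
          ((E.obj (op X)).map (biprod.inl : A ⟶ A ⊞ A') δ) +
        (E.map (biprod.snd : X ⊞ X' ⟶ X').op).app (A ⊞ A')
          ((E.obj (op X')).map (biprod.inr : A' ⟶ A ⊞ A') δ'))
  /-- (ET3) -/
  et3 : ∀ {A B X A' B' X' : C} {x : A ⟶ B} {y : B ⟶ X} {δ : (E.obj (op X)).obj A}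
    {x' : A' ⟶ B'} {y' : B' ⟶ X'} {δ' : (E.obj (op X')).obj A'},
    IsTriangle x y δ → IsTriangle x' y' δ' → ∀ (a : A ⟶ A') (b : B ⟶ B'), x ≫ b = a ≫ x' →
    ∃ c : X ⟶ X', y ≫ c = b ≫ y' ∧ (E.obj (op X)).map a δ = (E.map c.op).app A' δ'
  /-- (ET3)ᵒᵖ -/
  et3_op : ∀ {A B X A' B' X' : C} {x : A ⟶ B} {y : B ⟶ X} {δ : (E.obj (op X)).obj A}
    {x' : A' ⟶ B'} {y' : B' ⟶ X'} {δ' : (E.obj (op X')).obj A'},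
    IsTriangle x y δ → IsTriangle x' y' δ' → ∀ (b : B ⟶ B') (c : X ⟶ X'), y ≫ c = b ≫ y' →
    ∃ a : A ⟶ A', x ≫ b = a ≫ x' ∧ (E.obj (op X)).map a δ = (E.map c.op).app A' δ'
  /-- (ET4) -/
  et4 : ∀ {A B D X F : C} {f : A ⟶ B} {f' : B ⟶ D} {δ : (E.obj (op D)).obj A}
    {g : B ⟶ X} {g' : X ⟶ F} {δ' : (E.obj (op F)).obj B},
    IsTriangle f f' δ → IsTriangle g g' δ' →
    ∃ (Y : C) (h' : X ⟶ Y) (d : D ⟶ Y) (e : Y ⟶ F) (δ'' : (E.obj (op Y)).obj A),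
      f' ≫ d = g ≫ h' ∧ h' ≫ e = g' ∧
      IsTriangle (f ≫ g) h' δ'' ∧ IsTriangle d e ((E.obj (op F)).map f' δ') ∧
      δ = (E.map d.op).app A δ'' ∧ (E.obj (op Y)).map f δ'' = (E.map e.op).app B δ'
  /-- (ET4)ᵒᵖ -/
  et4_op : ∀ {D A B F X : C} {f' : D ⟶ A} {f : A ⟶ B} {δ : (E.obj (op B)).obj D}
    {g' : F ⟶ B} {g : B ⟶ X} {δ' : (E.obj (op X)).obj F},
    IsTriangle f' f δ → IsTriangle g' g δ' →
    ∃ (Y : C) (d : D ⟶ Y) (e : Y ⟶ F) (h' : Y ⟶ A) (δ'' : (E.obj (op X)).obj Y),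
      d ≫ h' = f' ∧ h' ≫ f = e ≫ g' ∧
      IsTriangle d e ((E.map g'.op).app D δ) ∧ IsTriangle h' (f ≫ g) δ'' ∧
      δ' = (E.obj (op X)).map e δ'' ∧ (E.obj (op B)).map d δ = (E.map g.op).app Y δ''

namespace Extriangulated

variable {k : Type w} [CommRing k] {C : Type u} [Category.{v} C] [Preadditive C]
  [Linear k C] [HasBinaryBiproducts C] (T : Extriangulated k C)

/-- An `𝔰`-triangle `X₁ ⟶ X₂ ⟶ X₃ ⇢`. -/
structure Triangle where
  /-- the first object -/
  X₁ : C
  /-- the second object -/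
  X₂ : C
  /-- the third object -/
  X₃ : C
  /-- the inflation -/
  f₁ : X₁ ⟶ X₂
  /-- the deflation -/
  f₂ : X₂ ⟶ X₃
  /-- the extension -/
  ρ : (T.E.obj (op X₃)).obj X₁
  isTriangle : T.IsTriangle f₁ f₂ ρ

/-- Every `E(X, Y)` is a finitely generated `k`-module; over an artinian `k` this is the same as
being of finite length. -/
def IsExtFinite : Prop := ∀ X Y : C, Module.Finite k ((T.E.obj (op X)).obj Y)

/-- The full subcategory `𝒫` of projective objects: those with the lifting property along all
deflations. -/
def proj : ObjectProperty C := fun P =>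
  ∀ (t : T.Triangle) (c : P ⟶ t.X₃), ∃ b : P ⟶ t.X₂, b ≫ t.f₂ = c

/-- The full subcategory `ℐ` of injective objects: those with the extension property along all
inflations. -/
def inj : ObjectProperty C := fun I =>
  ∀ (t : T.Triangle) (a : t.X₁ ⟶ I), ∃ b : t.X₂ ⟶ I, t.f₁ ≫ b = a

/-- For each `X` there is an `𝔰`-triangle `A ⟶ P ⟶ X ⇢` with `P` projective. -/
def EnoughProjectives : Prop :=
  ∀ X : C, ∃ (A P : C) (x : A ⟶ P) (y : P ⟶ X) (δ : (T.E.obj (op X)).obj A),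
    T.proj P ∧ T.IsTriangle x y δ

/-- For each `X` there is an `𝔰`-triangle `X ⟶ I ⟶ B ⇢` with `I` injective. -/
def EnoughInjectives : Prop :=
  ∀ X : C, ∃ (I B : C) (x : X ⟶ I) (y : I ⟶ B) (δ : (T.E.obj (op B)).obj X),
    T.inj I ∧ T.IsTriangle x y δ

variable [HasZeroObject C]

instance proj_isAdditiveClosed : IsAdditiveClosed T.proj where
  exists_zero := ⟨0, isZero_zero C, fun t c => ⟨0, by rw [zero_comp]; exact (isZero_zero C).eq_of_src _ _⟩⟩
  biprod X Y hX hY := fun t c => by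
    obtain ⟨b, hb⟩ := hX t (biprod.inl ≫ c)
    obtain ⟨b', hb'⟩ := hY t (biprod.inr ≫ c)
    exact ⟨biprod.desc b b', by ext <;> simp [hb, hb']⟩

instance inj_isAdditiveClosed : IsAdditiveClosed T.inj where
  exists_zero := ⟨0, isZero_zero C, fun t c => ⟨0, by rw [comp_zero]; exact (isZero_zero C).eq_of_tgt _ _⟩⟩
  biprod X Y hX hY := fun t c => by
    obtain ⟨b, hb⟩ := hX t (c ≫ biprod.fst)
    obtain ⟨b', hb'⟩ := hY t (c ≫ biprod.snd)
    exact ⟨biprod.lift b b', by ext <;> simp [hb, hb']⟩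

/-- The ideal quotient `C/[𝒫]`. -/
abbrev ModProj := IdealQuotient T.proj

/-- The ideal quotient `C/[ℐ]`. -/
abbrev ModInj := IdealQuotient T.inj

/-- The projection `C ⟶ C/[𝒫]`. -/
abbrev toModProj : C ⥤ T.ModProj := Quotient.functor _

/-- The projection `C ⟶ C/[ℐ]`. -/
abbrev toModInj : C ⥤ T.ModInj := Quotient.functor _

/-- The bifunctor `X ↦ D E(X, -)`, covariant in `X` and contravariant in `-`. -/
def dualExtFrom (J : Type v) [AddCommGroup J] [Module k J] :
    C ⥤ Cᵒᵖ ⥤ ModuleCat.{v} k where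
  obj X := dualOfLeft J (T.E.obj (op X))
  map f := Functor.whiskerRight (NatTrans.op (T.E.map f.op)) (dual k J)

/-- The bifunctor `X ↦ D E(-, X)`, contravariant in `X` and covariant in `-`. -/
def dualExtTo (J : Type v) [AddCommGroup J] [Module k J] :
    Cᵒᵖ ⥤ C ⥤ ModuleCat.{v} k where
  obj X := dualOfRight J (T.E.flip.obj X.unop)
  map f := Functor.whiskerRight (NatTrans.rightOp (T.E.flip.map f.unop)) (dual k J)

namespace Triangle

variable {T} (t : T.Triangle)

/-- The contravariant defect `δ^*`, a right `C`-module: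
`C(-, X₁) ⟶ C(-, X₂) ⟶ C(-, X₃) ⟶ δ^* ⟶ 0` is exact. -/
def contraDefect : Cᵒᵖ ⥤ ModuleCat.{v} k := cokernel ((linearYoneda k C).map t.f₂)

/-- The covariant defect `δ_*`, a left `C`-module:
`C(X₃, -) ⟶ C(X₂, -) ⟶ C(X₁, -) ⟶ δ_* ⟶ 0` is exact. -/
def covDefect : C ⥤ ModuleCat.{v} k := cokernel ((linearCoyoneda k C).map t.f₁.op)

theorem contraDefect_map_eq {X Y : C} (f g : X ⟶ Y) (h : idealRel T.proj f g) :
    t.contraDefect.map f.op = t.contraDefect.map g.op := by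
  obtain ⟨P, hP, a, b, e⟩ := h
  let p : (linearYoneda k C).obj t.X₃ ⟶ t.contraDefect := cokernel.π _
  have hp : Epi p := inferInstanceAs (Epi (cokernel.π _))
  have hw : (linearYoneda k C).map t.f₂ ≫ p = 0 := cokernel.condition _
  rw [← cancel_epi (p.app (op Y)), ← p.naturality, ← p.naturality]
  ext (h : Y ⟶ t.X₃)
  obtain ⟨c, hc⟩ := hP t (b ≫ h)
  have key : f ≫ h = g ≫ h + (a ≫ c) ≫ t.f₂ := by
    rw [Category.assoc, hc, ← Category.assoc, e, Preadditive.sub_comp]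
    abel
  have hz : (p.app (op X)).hom ((a ≫ c) ≫ t.f₂ : X ⟶ t.X₃) = 0 := by
    have := congrArg (fun q => (q.app (op X)).hom (a ≫ c : X ⟶ t.X₂)) hw
    exact this
  change (p.app (op X)).hom (f ≫ h : X ⟶ t.X₃) = (p.app (op X)).hom (g ≫ h : X ⟶ t.X₃)
  rw [key]
  refine (map_add (p.app (op X)).hom (g ≫ h : X ⟶ t.X₃) ((a ≫ c) ≫ t.f₂ : X ⟶ t.X₃)).trans ?_
  exact (congrArg _ hz).trans (add_zero _)

theorem covDefect_map_eq {X Y : C} (f g : X ⟶ Y) (h : idealRel T.inj f g) :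
    t.covDefect.map f = t.covDefect.map g := by
  obtain ⟨I, hI, a, b, e⟩ := h
  let p : (linearCoyoneda k C).obj (op t.X₁) ⟶ t.covDefect := cokernel.π _
  have hp : Epi p := inferInstanceAs (Epi (cokernel.π _))
  have hw : (linearCoyoneda k C).map t.f₁.op ≫ p = 0 := cokernel.condition _
  rw [← cancel_epi (p.app X), ← p.naturality, ← p.naturality]
  ext (h : t.X₁ ⟶ X)
  obtain ⟨c, hc⟩ := hI t (h ≫ a)
  have key : h ≫ f = h ≫ g + t.f₁ ≫ (c ≫ b) := by
    rw [← Category.assoc, hc, Category.assoc, e, Preadditive.comp_sub]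
    abel
  have hz : (p.app Y).hom (t.f₁ ≫ (c ≫ b) : t.X₁ ⟶ Y) = 0 := by
    have := congrArg (fun q => (q.app Y).hom (c ≫ b : t.X₂ ⟶ Y)) hw
    exact this
  change (p.app Y).hom (h ≫ f : t.X₁ ⟶ Y) = (p.app Y).hom (h ≫ g : t.X₁ ⟶ Y)
  rw [key]
  refine (map_add (p.app Y).hom (h ≫ g : t.X₁ ⟶ Y) (t.f₁ ≫ (c ≫ b) : t.X₁ ⟶ Y)).trans ?_
  exact (congrArg _ hz).trans (add_zero _)

/-- `δ^*` kills the morphisms that factor through projectives; this is `δ^*` viewed as a right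
`C/[𝒫]`-module. -/
def contraDefectModProj : T.ModProjᵒᵖ ⥤ ModuleCat.{v} k :=
  (CategoryTheory.Quotient.lift (idealRel T.proj) t.contraDefect.rightOp
    (fun _ _ f g h => congrArg Quiver.Hom.op (t.contraDefect_map_eq f g h))).leftOp

/-- `δ_*` kills the morphisms that factor through injectives; this is `δ_*` viewed as a left
`C/[ℐ]`-module. -/
def covDefectModInj : T.ModInj ⥤ ModuleCat.{v} k :=
  CategoryTheory.Quotient.lift (idealRel T.inj) t.covDefect (fun _ _ f g h => t.covDefect_map_eq f g h)

end Triangle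

end Extriangulated

end

end ARDuality

open ARDuality

set_option linter.unusedSectionVars false

/-! Everything happens in the extension bimodule, viewed as a functor `stableExt` on (C/[𝒫])ᵒᵖ ×
C/[ℐ]. The long exact sequences of 𝔰-triangles give three facts, collected in `IsStableExt`. (a) If
X → I → S is an 𝔰-triangle with I injective, then E(-, I) = 0, so C(-, I) → C(-, S) → E(-, X) → 0 is
exact. Hence E(-, X) is finitely presented over C/[𝒫], and by Yoneda the maps E(-, X) → E(-, Y) are
the morphisms X → Y in C/[ℐ]. (b) Adding a projective summand to the source turns any morphism into
a deflation without changing its class modulo [𝒫], so every finitely presented module embeds in some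
E(-, K). (c) The same device, with exactness in the middle term coming from (ET4)ᵒᵖ, makes E(-, X)
injective relative to finitely presented modules. All of this also holds for the flipped bimodule,
so it does not matter which quotient is dualizing.

Write M for the dualizing side, acting covariantly (an opposite is taken if necessary), and N for
the other side. As D E(-, X) is finitely generated, reflexivity embeds E(-, X) in some D M(-, V),
which is finitely presented. By (c) the embedding splits, so D E(-, X) is a summand of M(-, V), and
it is representable because idempotents split in M (`exists_representing`). The representing objects
form a functor σ : Nᵒᵖ → M, fully faithful by (a) and reflexivity. It is dense: by (b) D M(-, R)
embeds in some E(-, K), which makes R a retract of σ K (`exists_retract`), and idempotents split in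
N. This gives τ or τ⁻¹ and one of the two formulas in (1); the other follows from the adjunction
between τ⁻¹ and τ.

For (2), 0 → δ_* → E(X₃, -) → E(X₂, -) is exact. Applying the exact functor D and then (1) presents
D δ_* as the cokernel of C/[𝒫](τ⁻¹-, X₂) → C/[𝒫](τ⁻¹-, X₃), which is δ^* τ⁻¹. The other isomorphism
is dual. -/

namespace ARDuality

/-! ### The Matlis-type duality over an artinian ring -/

section Matlis

variable {k : Type w} [CommRing k]

/-- Embeds k/m in k/rad k. An artinian ring has finitely many maximal ideals, so some x lies in all
of them except m. -/
theorem exists_annihilated_of_isMaximal [IsArtinianRing k] (m : Ideal k) [hm : m.IsMaximal] :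
    ∃ x : k, x ∉ (⊥ : Ideal k).jacobson ∧ ∀ r ∈ m, r * x ∈ (⊥ : Ideal k).jacobson := by
  classical
  have := Fintype.ofFinite (MaximalSpectrum k)
  let s : Finset (MaximalSpectrum k) := Finset.univ.filter fun n => n.asIdeal ≠ m
  have h : ¬ (s.inf fun n => n.asIdeal) ≤ m := by
    intro h
    obtain ⟨n, hn, hnm⟩ := (Ideal.IsPrime.inf_le' hm.isPrime).1 h
    exact (Finset.mem_filter.1 hn).2 (n.isMaximal.eq_of_le hm.ne_top hnm)
  obtain ⟨x, hx, hxm⟩ := SetLike.not_le_iff_exists.1 h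
  refine ⟨x, fun hx' => hxm ?_, fun r hr => ?_⟩
  · exact Ideal.mem_sInf.1 hx' ⟨bot_le, hm⟩
  · refine Ideal.mem_sInf.2 ?_
    rintro n ⟨-, hn⟩
    by_cases hnm : n = m
    · exact hnm ▸ Ideal.mul_mem_right x _ hr
    · refine Ideal.mul_mem_left _ r ?_
      have : s.inf (fun n => n.asIdeal) ≤ n :=
        Finset.inf_le (f := fun n : MaximalSpectrum k => n.asIdeal) (b := ⟨n, hn⟩)
          (Finset.mem_filter.2 ⟨Finset.mem_univ _, hnm⟩)
      exact this hx

variable {J : Type v} [AddCommGroup J] [Module k J]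

theorem Module.Injective.exists_extension [Module.Injective k J] {M N : Type v} [AddCommGroup M]
    [AddCommGroup N] [Module k M] [Module k N] (f : M →ₗ[k] N) (hf : Function.Injective f)
    (g : M →ₗ[k] J) : ∃ h : N →ₗ[k] J, h ∘ₗ f = g := by
  obtain ⟨h, hh⟩ := Module.Injective.out f hf g
  exact ⟨h, LinearMap.ext hh⟩

/-- A functional vanishing on the kernel of `f` factors through `f`. -/
theorem Module.Injective.exists_factor [Module.Injective k J] {M N : Type v} [AddCommGroup M]
    [AddCommGroup N] [Module k M] [Module k N] (f : M →ₗ[k] N) (g : M →ₗ[k] J)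
    (hg : ∀ x, f x = 0 → g x = 0) : ∃ h : N →ₗ[k] J, h ∘ₗ f = g := by
  let f' : (M ⧸ LinearMap.ker f) →ₗ[k] N := (LinearMap.ker f).liftQ f le_rfl
  have hf' : Function.Injective f' := by
    rw [← LinearMap.ker_eq_bot]
    exact Submodule.ker_liftQ_eq_bot _ _ _ le_rfl
  obtain ⟨h, hh⟩ := Module.Injective.exists_extension f' hf' ((LinearMap.ker f).liftQ g hg)
  refine ⟨h, LinearMap.ext fun x => ?_⟩
  exact LinearMap.congr_fun hh (Submodule.Quotient.mk x)

variable [IsArtinianRing k] (hJ : IsInjectiveEnvelopeOfTop k J)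

include hJ

/-- J is a cogenerator: the cyclic module k x has a simple quotient k/m, which embeds in k/rad k and
so in J; injectivity extends the resulting functional to M. -/
theorem IsInjectiveEnvelopeOfTop.exists_apply_ne_zero {M : Type v} [AddCommGroup M] [Module k M]
    {x : M} (hx : x ≠ 0) : ∃ φ : M →ₗ[k] J, φ x ≠ 0 := by
  have := hJ.injective
  obtain ⟨i, hi, -⟩ := hJ.exists_essential
  have hann : LinearMap.ker (LinearMap.toSpanSingleton k M x) ≠ ⊤ := fun h => hx <| by
    simpa using (h ▸ Submodule.mem_top : (1 : k) ∈ LinearMap.ker (LinearMap.toSpanSingleton k M x))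
  obtain ⟨m, hm, hle⟩ := Ideal.exists_le_maximal _ hann
  obtain ⟨a, ha, hma⟩ := exists_annihilated_of_isMaximal m
  -- The functional 1 ↦ i(a mod rad k) kills m, hence the annihilator of x, so it descends to k x.
  let t : k →ₗ[k] J := i ∘ₗ (Submodule.mkQ _) ∘ₗ LinearMap.toSpanSingleton k k a
  let s : k →ₗ[k] (k ∙ x) := (LinearMap.toSpanSingleton k M x).codRestrict _
    fun r => Submodule.mem_span_singleton.2 ⟨r, rfl⟩
  have hs : Function.Surjective s := by
    rintro ⟨y, hy⟩
    obtain ⟨r, rfl⟩ := Submodule.mem_span_singleton.1 hy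
    exact ⟨r, rfl⟩
  have hst : LinearMap.ker s ≤ LinearMap.ker t := by
    intro r hr
    have hr' : r ∈ LinearMap.ker (LinearMap.toSpanSingleton k M x) :=
      congrArg Subtype.val (LinearMap.mem_ker.1 hr)
    have h0 : Submodule.mkQ (⊥ : Ideal k).jacobson (r * a) = 0 :=
      (Submodule.Quotient.mk_eq_zero _).2 (hma r (hle hr'))
    exact (congrArg i h0).trans (map_zero i)
  let t' : (k ∙ x) →ₗ[k] J :=
    (LinearMap.ker s).liftQ t hst ∘ₗ (s.quotKerEquivOfSurjective hs).symm.toLinearMap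
  obtain ⟨φ, hφ⟩ := Module.Injective.exists_extension (Submodule.subtype _)
    (Submodule.subtype_injective _) t'
  refine ⟨φ, fun h => ha ?_⟩
  have e1 : s 1 = ⟨x, Submodule.mem_span_singleton_self x⟩ := Subtype.ext (one_smul k x)
  have e2 : t' (s 1) = t 1 := by
    have : (s.quotKerEquivOfSurjective hs).symm (s 1) = Submodule.Quotient.mk 1 := by
      rw [LinearEquiv.symm_apply_eq]; rfl
    simp only [t', LinearMap.comp_apply, LinearEquiv.coe_coe, this]
    rfl
  have e3 : t 1 = 0 := by
    rw [← e2, ← hφ, e1]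
    exact h
  have e4 : Submodule.mkQ (⊥ : Ideal k).jacobson ((1 : k) • a) = 0 :=
    hi (e3.trans (map_zero i).symm)
  rw [one_smul] at e4
  exact (Submodule.Quotient.mk_eq_zero _).1 e4

theorem IsInjectiveEnvelopeOfTop.eq_of_forall_apply_eq {M : Type v} [AddCommGroup M] [Module k M]
    {x y : M} (h : ∀ φ : M →ₗ[k] J, φ x = φ y) : x = y := by
  by_contra hxy
  obtain ⟨φ, hφ⟩ := hJ.exists_apply_ne_zero (sub_ne_zero.2 hxy)
  exact hφ (by rw [map_sub, h, sub_self])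

/-- Functionals on a simple module are determined up to scalars. -/
theorem IsInjectiveEnvelopeOfTop.exists_smul_eq {S : Type v} [AddCommGroup S] [Module k S]
    [IsSimpleModule k S] {φ : S →ₗ[k] J} (hφ : φ ≠ 0) (ψ : S →ₗ[k] J) :
    ∃ r : k, r • φ = ψ := by
  obtain ⟨i, hi, hess⟩ := hJ.exists_essential
  by_cases hψ : ψ = 0
  · exact ⟨0, by simp [hψ]⟩
  -- The image of χ is simple and meets the essential submodule k/rad k, so it lies inside it. The
  -- values of φ and ψ at a generator thus become classes a, b of ring elements.
  have key : ∀ χ : S →ₗ[k] J, χ ≠ 0 → LinearMap.range χ ≤ LinearMap.range i := by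
    intro χ hχ
    have hinj : Function.Injective χ := χ.injective_or_eq_zero.resolve_right hχ
    have hne : LinearMap.range χ ⊓ LinearMap.range i ≠ ⊥ := fun h =>
      hχ (LinearMap.range_eq_bot.1 (hess _ h))
    obtain ⟨_, ⟨⟨s, rfl⟩, ht⟩, hs0⟩ := Submodule.exists_mem_ne_zero_of_ne_bot hne
    have hcomap : (LinearMap.range i).comap χ = ⊤ := by
      refine (eq_bot_or_eq_top _).resolve_left fun h => hs0 ?_
      have : s ∈ (LinearMap.range i).comap χ := ht
      rw [h, Submodule.mem_bot] at this
      rw [this, map_zero]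
    rintro _ ⟨z, rfl⟩
    have : z ∈ (LinearMap.range i).comap χ := hcomap ▸ Submodule.mem_top
    exact this
  have := IsSimpleModule.nontrivial k S
  obtain ⟨s, hs⟩ := exists_ne (0 : S)
  have hspan : ∀ z : S, ∃ r : k, r • s = z := fun z =>
    IsSimpleModule.toSpanSingleton_surjective k hs z
  obtain ⟨a', ha'⟩ := key φ hφ ⟨s, rfl⟩
  obtain ⟨b', hb'⟩ := key ψ hψ ⟨s, rfl⟩
  obtain ⟨a, rfl⟩ := Submodule.Quotient.mk_surjective _ a'
  obtain ⟨b, rfl⟩ := Submodule.Quotient.mk_surjective _ b'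
  let m : Ideal k := LinearMap.ker (LinearMap.toSpanSingleton k S s)
  have hm : m.IsMaximal := IsSimpleModule.ker_toSpanSingleton_isMaximal k hs
  have hφinj : Function.Injective φ := φ.injective_or_eq_zero.resolve_right hφ
  have hma : ∀ r ∈ m, ∀ (χ : S →ₗ[k] J) (c : k), i (Submodule.Quotient.mk c) = χ s →
      r * c ∈ (⊥ : Ideal k).jacobson := by
    intro r hr χ c hc
    have hr' : r • s = 0 := hr
    have : i (Submodule.Quotient.mk (r • c)) = 0 := by
      rw [Submodule.Quotient.mk_smul, map_smul, hc, ← map_smul, hr', map_zero]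
    exact (Submodule.Quotient.mk_eq_zero _).1 (hi (this.trans (map_zero i).symm))
  -- Otherwise a² would lie in rad k, hence a as well, because rad k is an intersection of primes;
  -- then φ s = 0.
  have ham : a ∉ m := by
    intro h
    have h1 : a * a ∈ (⊥ : Ideal k).jacobson := hma a h φ a ha'
    have h2 : a ∈ (⊥ : Ideal k).jacobson := by
      refine Ideal.mem_sInf.2 ?_
      rintro n ⟨-, hn⟩
      exact (or_self_iff.1 (hn.isPrime.mem_or_mem (Ideal.mem_sInf.1 h1 ⟨bot_le, hn⟩)))
    have h3 : φ s = 0 := by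
      rw [← ha', (Submodule.Quotient.mk_eq_zero _).2 h2, map_zero]
    exact hs (hφinj (h3.trans (map_zero φ).symm))
  obtain ⟨c, n, hn, hcn⟩ := hm.exists_inv ham
  -- Here c inverts a modulo m, and m b ⊆ rad k, so c b a ≡ b modulo rad k.
  refine ⟨c * b, LinearMap.ext fun z => ?_⟩
  obtain ⟨r, rfl⟩ := hspan z
  have : (c * b) • φ s = ψ s := by
    rw [← ha', ← hb', ← map_smul, ← Submodule.Quotient.mk_smul]
    congr 1
    refine (Submodule.Quotient.eq _).2 ?_
    have : (c * b) • a - b = - (n * b) := by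
      rw [smul_eq_mul]; linear_combination b * hcn
    rw [this]
    exact neg_mem (hma n hn ψ b hb')
  rw [LinearMap.smul_apply, map_smul, map_smul, smul_comm, this]

/-- Induction on the length: D is exact, and the dual of a simple module is zero or simple by
`exists_smul_eq`. -/
theorem IsInjectiveEnvelopeOfTop.length_dual_le {M : Type v} [AddCommGroup M] [Module k M]
    (hM : IsFiniteLength k M) : Module.length k (M →ₗ[k] J) ≤ Module.length k M := by
  induction hM with
  | of_subsingleton =>
    rw [Module.length_eq_zero_iff.2 ⟨fun f g => LinearMap.ext fun x => by
      rw [Subsingleton.elim x 0, map_zero, map_zero]⟩]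
    exact zero_le
  | @of_simple_quotient M _ _ N hs hN ih =>
    have hsimple : Module.length k ((M ⧸ N) →ₗ[k] J) ≤ 1 := by
      by_cases h : ∀ φ : (M ⧸ N) →ₗ[k] J, φ = 0
      · rw [Module.length_eq_zero_iff.2 ⟨fun f g => (h f).trans (h g).symm⟩]
        exact zero_le
      · push Not at h
        obtain ⟨φ, hφ⟩ := h
        refine (Module.length_eq_one_iff.2 ?_).le
        rw [isSimpleModule_iff_toSpanSingleton_surjective]
        exact ⟨⟨φ, 0, hφ⟩, fun φ hφ ψ => hJ.exists_smul_eq hφ ψ⟩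
    rw [Module.length_eq_add_of_exact N.subtype N.mkQ N.subtype_injective N.mkQ_surjective
      (LinearMap.exact_subtype_mkQ N)]
    have := hJ.injective
    let p : (M →ₗ[k] J) →ₗ[k] (N →ₗ[k] J) := LinearMap.lcomp k J N.subtype
    let q : ((M ⧸ N) →ₗ[k] J) →ₗ[k] (M →ₗ[k] J) := LinearMap.lcomp k J N.mkQ
    have hp : Function.Surjective p := fun g =>
      Module.Injective.exists_extension _ N.subtype_injective g
    have hq : Function.Injective q := fun f g h => by
      refine LinearMap.ext fun x => ?_
      obtain ⟨x, rfl⟩ := N.mkQ_surjective x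
      exact LinearMap.congr_fun h x
    have hpq : Function.Exact q p := by
      intro f
      constructor
      · intro hf
        obtain ⟨h, hh⟩ := Module.Injective.exists_factor N.mkQ f fun x hx =>
          LinearMap.congr_fun hf ⟨x, (Submodule.Quotient.mk_eq_zero N).1 hx⟩
        exact ⟨h, hh⟩
      · rintro ⟨g, rfl⟩
        refine LinearMap.ext fun x => ?_
        change g (N.mkQ x) = 0
        rw [Submodule.mkQ_apply, (Submodule.Quotient.mk_eq_zero N).2 x.2, map_zero]
    rw [Module.length_eq_add_of_exact q p hq hp hpq, add_comm]
    rw [Module.length_eq_one_iff.2 hs]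
    gcongr

/-- Finitely generated modules over an artinian ring are reflexive. -/
theorem IsInjectiveEnvelopeOfTop.bijective_eval {M : Type v} [AddCommGroup M] [Module k M]
    [Module.Finite k M] :
    Function.Bijective (LinearMap.applyₗ : M →ₗ[k] (M →ₗ[k] J) →ₗ[k] J) := by
  have hM : IsFiniteLength k M := isFiniteLength_iff_isNoetherian_isArtinian.2
    ⟨inferInstance, inferInstance⟩
  have hinj : Function.Injective (LinearMap.applyₗ : M →ₗ[k] (M →ₗ[k] J) →ₗ[k] J) :=
    fun x y h => hJ.eq_of_forall_apply_eq fun φ => LinearMap.congr_fun h φ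
  have hD : IsFiniteLength k (M →ₗ[k] J) := Module.length_ne_top_iff.1
    (ne_top_of_le_ne_top (Module.length_ne_top_iff.2 hM) (hJ.length_dual_le hM))
  have hDD : IsFiniteLength k ((M →ₗ[k] J) →ₗ[k] J) := Module.length_ne_top_iff.1
    (ne_top_of_le_ne_top (Module.length_ne_top_iff.2 hD) (hJ.length_dual_le hD))
  obtain ⟨_, _⟩ := isFiniteLength_iff_isNoetherian_isArtinian.1 hDD
  -- The double dual is no longer than M, so the injective evaluation map cannot have a proper
  -- image.
  refine ⟨hinj, LinearMap.range_eq_top.1 ?_⟩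
  by_contra h
  refine (Submodule.length_lt h).not_ge ?_
  rw [← (LinearEquiv.ofInjective _ hinj).length_eq]
  exact (hJ.length_dual_le hD).trans (hJ.length_dual_le hM)

end Matlis

/-- The idempotent r ≫ i on F X comes from an idempotent on X; the image of its splitting is Y. -/
theorem essImage_of_retract {A B : Type*} [Category* A] [Category* B] [IsIdempotentComplete A]
    (F : A ⥤ B) [F.Full] [F.Faithful] {X : A} {Y : B} (i : Y ⟶ F.obj X) (r : F.obj X ⟶ Y)
    (h : i ≫ r = 𝟙 Y) : F.essImage Y := by
  obtain ⟨Z, a, b, hab, hba⟩ := IsIdempotentComplete.idempotents_split X (F.preimage (r ≫ i))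
    (F.map_injective (by simp [reassoc_of% h]))
  have hba' : F.map b ≫ F.map a = r ≫ i := by rw [← F.map_comp, hba, F.map_preimage]
  have hab' : F.map a ≫ F.map b = 𝟙 _ := by rw [← F.map_comp, hab, F.map_id]
  refine ⟨Z, ⟨⟨F.map a ≫ r, i ≫ F.map b, ?_, ?_⟩⟩⟩
  · rw [Category.assoc, ← reassoc_of% hba', hab', Category.comp_id, hab']
  · rw [Category.assoc, reassoc_of% hba', h, Category.comp_id, h]

section Bimodule

variable {k : Type w} [CommRing k] {M N : Type u} [Category.{v} M] [Category.{v} N]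

/-! ### Bimodules -/

section

variable (E : M ⥤ N ⥤ ModuleCat.{v} k)

/-- The action of the first variable. -/
def lact {S V : M} (h : S ⟶ V) (X : N) : (E.obj S).obj X →ₗ[k] (E.obj V).obj X :=
  ((E.map h).app X).hom

/-- The action of the second variable. -/
def ract (S : M) {X Y : N} (b : X ⟶ Y) : (E.obj S).obj X →ₗ[k] (E.obj S).obj Y :=
  ((E.obj S).map b).hom

@[simp]
theorem lact_id (S : M) (X : N) (e : (E.obj S).obj X) : lact E (𝟙 S) X e = e := by
  simp [lact]

theorem lact_comp {S V W : M} (h : S ⟶ V) (g : V ⟶ W) (X : N) (e : (E.obj S).obj X) :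
    lact E (h ≫ g) X e = lact E g X (lact E h X e) := by
  simp [lact]

@[simp]
theorem ract_id (S : M) (X : N) (e : (E.obj S).obj X) : ract E S (𝟙 X) e = e := by
  simp [ract]

theorem ract_comp (S : M) {X Y Z : N} (b : X ⟶ Y) (c : Y ⟶ Z) (e : (E.obj S).obj X) :
    ract E S (b ≫ c) e = ract E S c (ract E S b e) := by
  simp [ract]

theorem lact_ract {S V : M} (h : S ⟶ V) {X Y : N} (b : X ⟶ Y) (e : (E.obj S).obj X) :
    lact E h Y (ract E S b e) = ract E V b (lact E h X e) :=
  LinearMap.congr_fun (congrArg ModuleCat.Hom.hom ((E.map h).naturality b)) e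

/-- The bimodule `D E`. -/
noncomputable def dualBimodule (J : Type v) [AddCommGroup J] [Module k J] :
    Nᵒᵖ ⥤ Mᵒᵖ ⥤ ModuleCat.{v} k where
  obj X := dualOfLeft J (E.flip.obj X.unop)
  map f := Functor.whiskerRight (NatTrans.op (E.flip.map f.unop)) (dual k J)

end

variable [Preadditive M] [Linear k M]

/-- The properties of the stable `Ext` bimodule that give the duality: `embeds` says that the finitely
presented modules embed in the modules `E(-, X)`, `presented` that the latter are finitely presented
and depend fully faithfully on `X`, and `extends` that they are injective relative to finitely presented
modules. -/
structure IsStableExt (E : M ⥤ N ⥤ ModuleCat.{v} k) : Prop where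
  map_add : ∀ {S V : M} (h g : S ⟶ V) (X : N) (e : (E.obj S).obj X),
    lact E (h + g) X e = lact E h X e + lact E g X e
  map_smul : ∀ {S V : M} (r : k) (h : S ⟶ V) (X : N) (e : (E.obj S).obj X),
    lact E (r • h) X e = r • lact E h X e
  embeds : ∀ {Z Y : M} (f : Z ⟶ Y), ∃ (K : N) (δ : (E.obj Z).obj K),
    ∀ {V : M} (h : Z ⟶ V), lact E h K δ = 0 ↔ ∃ g : Y ⟶ V, f ≫ g = h
  presented : ∀ X : N, ∃ (S I : M) (v : S ⟶ I) (u : (E.obj S).obj X),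
    (∀ (V : M) (e : (E.obj V).obj X), ∃ h : S ⟶ V, lact E h X u = e) ∧
    (∀ {V : M} (h : S ⟶ V), lact E h X u = 0 ↔ ∃ g : I ⟶ V, v ≫ g = h) ∧
    (∀ {Y : N} (u' : (E.obj S).obj Y), lact E v Y u' = 0 → ∃! b : X ⟶ Y, ract E S b u = u')
  extends_along : ∀ {Z S Y : M} (g : Z ⟶ S) (f : Z ⟶ Y) {X : N} (u : (E.obj S).obj X),
    (∀ {V : M} (a : S ⟶ V) (b : Y ⟶ V), g ≫ a + f ≫ b = 0 → lact E a X u = 0) →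
    ∃ r : (E.obj Z).obj X, lact E g X r = u ∧ lact E f X r = 0

/-- The part of the definition of a dualizing variety that is used, in terms of elements: the modules
`D E(-, X)` are finitely generated, and the modules `D M(-, V)` are finitely presented. -/
structure IsDualizingFor (E : M ⥤ N ⥤ ModuleCat.{v} k) (J : Type v) [AddCommGroup J]
    [Module k J] : Prop where
  generator : ∀ X : N, ∃ (V : M) (p : (E.obj V).obj X →ₗ[k] J),
    ∀ {W : M} (φ : (E.obj W).obj X →ₗ[k] J), ∃ h : W ⟶ V, ∀ e, φ e = p (lact E h X e)
  presentation : ∀ V : M, ∃ (Z Y : M) (f : Z ⟶ Y) (z : (Z ⟶ V) →ₗ[k] J),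
    (∀ {W : M} (α : (W ⟶ V) →ₗ[k] J), ∃ h : Z ⟶ W, ∀ x, α x = z (h ≫ x)) ∧
    (∀ g : Y ⟶ V, z (f ≫ g) = 0) ∧
    (∀ {W : M} (h : Z ⟶ W), (∀ x : W ⟶ V, z (h ≫ x) = 0) → ∃ g : Y ⟶ W, f ≫ g = h)

variable {E : M ⥤ N ⥤ ModuleCat.{v} k}

/-! ### Representability of the dual modules, and the abstract duality -/

namespace IsStableExt

variable (hE : IsStableExt E)

include hE

/-- Evaluation at an element of the bimodule, as a linear map. -/
def orbit {S : M} {X : N} (e : (E.obj S).obj X) (V : M) : (S ⟶ V) →ₗ[k] (E.obj V).obj X where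
  toFun h := lact E h X e
  map_add' h g := hE.map_add h g X e
  map_smul' r h := hE.map_smul r h X e

/-- The transformation `M(-, R) ⟶ D E(-, X)` given by an element `q` of `D E(R, X)`. -/
def orbitDual {R : M} {X : N} {J : Type v} [AddCommGroup J] [Module k J]
    (q : (E.obj R).obj X →ₗ[k] J) (W : M) : (W ⟶ R) →ₗ[k] ((E.obj W).obj X →ₗ[k] J) where
  toFun h := q ∘ₗ lact E h X
  map_add' h g := LinearMap.ext fun e => by
    change q (lact E (h + g) X e) = q (lact E h X e) + q (lact E g X e)
    rw [hE.map_add, _root_.map_add]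
  map_smul' r h := LinearMap.ext fun e => by
    change q (lact E (r • h) X e) = r • q (lact E h X e)
    rw [hE.map_smul, _root_.map_smul]

variable [IsArtinianRing k] {J : Type v} [AddCommGroup J] [Module k J]
  (hJ : IsInjectiveEnvelopeOfTop k J) (hfin : ∀ X Y : M, Module.Finite k (X ⟶ Y))

include hJ hfin

omit hE in
/-- A functional `Ψ` on `M(Z, W)` that vanishes on the kernel of the projection
`M(Z, W) ⟶ D M(W, V)` is represented by a morphism `W ⟶ V`. -/
theorem exists_hom_of_functional {Z V W : M} (z : (Z ⟶ V) →ₗ[k] J) (Ψ : (Z ⟶ W) →ₗ[k] J)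
    (hΨ : ∀ h : Z ⟶ W, (∀ x : W ⟶ V, z (h ≫ x) = 0) → Ψ h = 0) :
    ∃ ε : W ⟶ V, ∀ h : Z ⟶ W, z (h ≫ ε) = Ψ h := by
  have := hJ.injective
  have := hfin W V
  let c : (Z ⟶ W) →ₗ[k] (W ⟶ V) →ₗ[k] J := (Linear.comp Z W V).compr₂ z
  obtain ⟨Φ, hΦ⟩ := Module.Injective.exists_factor c Ψ fun h hh =>
    hΨ h fun x => LinearMap.congr_fun hh x
  obtain ⟨ε, rfl⟩ := hJ.bijective_eval.2 Φ
  exact ⟨ε, fun h => LinearMap.congr_fun hΦ h⟩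

/-- Dually to the surjection M(-, V) → D E(-, X), the module E(-, X) embeds in D M(-, V). Relative
injectivity retracts this embedding, and R is the corresponding summand of V. -/
theorem exists_representing [IsIdempotentComplete M] (hD : IsDualizingFor E J) (X : N) :
    ∃ (R : M) (q : (E.obj R).obj X →ₗ[k] J), ∀ W : M, Function.Bijective (hE.orbitDual q W) := by
  obtain ⟨V, p, hp⟩ := hD.generator X
  obtain ⟨Z, Y, f, z, hz₁, hz₂, hz₃⟩ := hD.presentation V
  obtain ⟨S, I, v, u, hu, -, -⟩ := hE.presented X
  -- On presentations, g : Z ⟶ S describes the embedding of E(-, X) in D M(-, V).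
  obtain ⟨g, hg⟩ := hz₁ (p ∘ₗ hE.orbit u V)
  replace hg : ∀ x : S ⟶ V, p (lact E x X u) = z (g ≫ x) := hg
  -- The element r describes the retraction D M(-, V) → E(-, X). The condition to check says that
  -- the embedding is injective, tested against the functionals p(h · -), which are all functionals.
  obtain ⟨r, hr₁, hr₂⟩ := hE.extends_along g f u fun {V'} a b hab =>
    hJ.eq_of_forall_apply_eq fun φ => by
      obtain ⟨h, hh⟩ := hp φ
      have : g ≫ a ≫ h = - (f ≫ b ≫ h) := by
        rw [← Category.assoc, ← Category.assoc, eq_neg_of_add_eq_zero_left hab,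
          Preadditive.neg_comp]
      rw [hh, ← lact_comp, hg, this, map_neg, hz₂, neg_zero, map_zero]
  -- The retraction followed by the embedding is an endomorphism of D M(-, V); ε is the endomorphism
  -- of V of which it is the dual.
  obtain ⟨ε, hε⟩ := exists_hom_of_functional hJ hfin z (p ∘ₗ hE.orbit r V) fun h hh => by
    obtain ⟨y, rfl⟩ := hz₃ h hh
    change p (lact E (f ≫ y) X r) = 0
    rw [lact_comp, hr₂, map_zero, map_zero]
  replace hε : ∀ h : Z ⟶ V, z (h ≫ ε) = p (lact E h X r) := hε
  have hpε : ∀ e, p (lact E ε X e) = p e := fun e => by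
    obtain ⟨h, rfl⟩ := hu V e
    rw [← lact_comp, hg, ← Category.assoc, hε, lact_comp, hr₁]
  -- The kernel of M(W, V) → D E(W, X) is annihilated by ε. As ε - 1 lies in this kernel for W = V,
  -- ε is idempotent.
  have hx : ∀ {W : M} (x : W ⟶ V), (∀ e, p (lact E x X e) = 0) → x ≫ ε = 0 := by
    intro W x hx
    refine hJ.eq_of_forall_apply_eq fun α => ?_
    obtain ⟨h, hh⟩ := hz₁ α
    rw [hh, ← Category.assoc, hε, lact_comp, hx, map_zero]
  have hidem : ε ≫ ε = ε := by
    have := hx (ε - 𝟙 V) fun e => by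
      have h1 : lact E ε X e = lact E (ε - 𝟙 V) X e + lact E (𝟙 V) X e := by
        rw [← hE.map_add, sub_add_cancel]
      rw [eq_sub_of_add_eq h1.symm, map_sub, hpε, lact_id, sub_self]
    rwa [Preadditive.sub_comp, Category.id_comp, sub_eq_zero] at this
  obtain ⟨R, b, a, hba, hab⟩ := IsIdempotentComplete.idempotents_split V ε hidem
  refine ⟨R, p ∘ₗ lact E b X, fun W => ⟨?_, fun φ => ?_⟩⟩
  · rw [injective_iff_map_eq_zero]
    intro x h0
    have h1 : (x ≫ b) ≫ ε = 0 := hx _ fun e => by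
      rw [lact_comp]
      exact LinearMap.congr_fun h0 e
    rw [← hab, Category.assoc, reassoc_of% hba] at h1
    rw [← Category.comp_id x, ← hba, reassoc_of% h1, zero_comp]
  · obtain ⟨h, hh⟩ := hp φ
    refine ⟨h ≫ a, LinearMap.ext fun e => ?_⟩
    change p (lact E b X (lact E (h ≫ a) X e)) = _
    rw [← lact_comp, Category.assoc, hab, lact_comp, hpε, hh]

-- J cogenerates, so equal duals act equally on the generator u of E(-, Y), and u detects morphisms
-- out of Y in N.
omit hfin in
theorem faithful_dualBimodule : (dualBimodule E J).Faithful where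
  map_injective {X Y} f g hfg := by
    obtain ⟨S, I, v, u, -, hu, hb⟩ := hE.presented Y.unop
    refine Quiver.Hom.unop_inj ((hb (ract E S f.unop u) ?_).unique rfl ?_)
    · rw [lact_ract, (hu v).2 ⟨𝟙 _, Category.comp_id _⟩, map_zero]
    · refine hJ.eq_of_forall_apply_eq fun φ => ?_
      exact (LinearMap.congr_fun (LinearMap.congr_fun (congrArg ModuleCat.Hom.hom
        (congrArg (fun η => NatTrans.app η (op S)) hfg)) φ) u).symm

-- Reflexivity of E(S, X) turns the dual transformation into an element u' of E(S, X) as the image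
-- of the generator u. It satisfies v u' = 0 because u does, so `presented` yields the morphism.
omit hfin in
theorem full_dualBimodule (hfinE : ∀ S X, Module.Finite k ((E.obj S).obj X)) :
    (dualBimodule E J).Full where
  map_surjective {X Y} η := by
    obtain ⟨S, I, v, u, hu₁, hu, hb⟩ := hE.presented Y.unop
    have := hfinE S X.unop
    let η' : ∀ W : M, ((E.obj W).obj X.unop →ₗ[k] J) →ₗ[k] ((E.obj W).obj Y.unop →ₗ[k] J) :=
      fun W => (η.app (op W)).hom
    have hη : ∀ {W W' : M} (h : W ⟶ W') (φ : (E.obj W').obj X.unop →ₗ[k] J) e,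
        η' W (φ ∘ₗ lact E h X.unop) e = η' W' φ (lact E h Y.unop e) := fun h φ e =>
      LinearMap.congr_fun (LinearMap.congr_fun (congrArg ModuleCat.Hom.hom
        (η.naturality h.op)) φ) e
    obtain ⟨u', hu'⟩ := hJ.bijective_eval.2 (LinearMap.applyₗ u ∘ₗ η' S)
    replace hu' : ∀ φ : (E.obj S).obj X.unop →ₗ[k] J, φ u' = η' S φ u := fun φ =>
      LinearMap.congr_fun hu' φ
    obtain ⟨b, hb, -⟩ := hb u' (hJ.eq_of_forall_apply_eq fun φ => by
      have := hu' (φ ∘ₗ lact E v X.unop)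
      rw [hη, (hu v).2 ⟨𝟙 _, Category.comp_id _⟩, map_zero] at this
      rw [map_zero]
      exact this)
    refine ⟨b.op, NatTrans.ext (funext fun W => ModuleCat.hom_ext (LinearMap.ext
      fun (φ : (E.obj W.unop).obj X.unop →ₗ[k] J) =>
        LinearMap.ext fun (e : (E.obj W.unop).obj Y.unop) => ?_))⟩
    obtain ⟨h, rfl⟩ := hu₁ W.unop e
    change φ (ract E W.unop b (lact E h Y.unop u)) = η' W.unop φ (lact E h Y.unop u)
    rw [← hη, ← hu', ← lact_ract, hb]
    rfl

/-- The module D M(-, R) embeds in E(-, K), so M(-, R) is a quotient of D E(-, K) and hence of M(-,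
R'). Such an epimorphism onto a representable splits. -/
theorem exists_retract (hD : IsDualizingFor E J) (R : M) : ∃ K : N, ∀ (R' : M)
    (q : (E.obj R').obj K →ₗ[k] J), (∀ W, Function.Surjective (hE.orbitDual q W)) →
      ∃ (i : R ⟶ R') (r : R' ⟶ R), i ≫ r = 𝟙 R := by
  have := hJ.injective
  obtain ⟨Z, Y, f, z, hz₁, hz₂, hz₃⟩ := hD.presentation R
  obtain ⟨K, δ, hδ⟩ := hE.embeds f
  refine ⟨K, fun R' q hq => ?_⟩
  obtain ⟨φ, hφ⟩ := Module.Injective.exists_factor (hE.orbit δ R) z fun h hh => by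
    obtain ⟨g, rfl⟩ := (hδ h).1 hh
    exact hz₂ g
  replace hφ : ∀ h : Z ⟶ R, φ (lact E h K δ) = z h := fun h => LinearMap.congr_fun hφ h
  -- φ extends z along the embedding, so it is a lift of the identity of R to D E(R, K); i lifts it
  -- further to M(R, R'), and r below is the epimorphism itself.
  obtain ⟨i, rfl⟩ := hq R φ
  obtain ⟨r, hr⟩ := exists_hom_of_functional hJ hfin z (q ∘ₗ hE.orbit δ R') fun h hh => by
    change q (lact E h K δ) = 0
    rw [(hδ h).2 (hz₃ h hh), map_zero]
  replace hr : ∀ h : Z ⟶ R', z (h ≫ r) = q (lact E h K δ) := hr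
  refine ⟨i, r, hJ.eq_of_forall_apply_eq fun α => ?_⟩
  obtain ⟨h, hh⟩ := hz₁ α
  rw [hh, hh, ← Category.assoc, hr, Category.comp_id, lact_comp, ← hφ]
  rfl

/-- The duality for an abstract `Ext` bimodule. -/
theorem exists_equivalence [IsIdempotentComplete M] [IsIdempotentComplete N]
    (hD : IsDualizingFor E J) :
    ∃ σ : Nᵒᵖ ⥤ M, σ.IsEquivalence ∧ Nonempty (σ ⋙ linearYoneda k M ≅ dualBimodule E J) := by
  have hfinE : ∀ S X, Module.Finite k ((E.obj S).obj X) := fun V X => by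
    obtain ⟨S, I, v, u, hu, -, -⟩ := hE.presented X
    have := hfin S V
    exact Module.Finite.of_surjective (hE.orbit u V) (hu V)
  have := hE.faithful_dualBimodule hJ
  have := hE.full_dualBimodule hJ hfinE
  have hG : ∀ X, (linearYoneda k M).essImage ((dualBimodule E J).obj X) := fun X => by
    obtain ⟨R, q, hq⟩ := hE.exists_representing hJ hfin hD X.unop
    refine ⟨R, ⟨NatIso.ofComponents
      (fun W => (LinearEquiv.ofBijective _ (hq W.unop)).toModuleIso) fun {W W'} f => ?_⟩⟩
    refine ModuleCat.hom_ext (LinearMap.ext fun h => LinearMap.ext fun e => ?_)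
    exact congrArg q (lact_comp E f.unop h _ e)
  let σ := Functor.essImage.liftFunctor (dualBimodule E J) (linearYoneda k M) hG
  let θ : σ ⋙ linearYoneda k M ≅ dualBimodule E J := Functor.essImage.liftFunctorCompIso _ _ hG
  have : σ.Faithful := Functor.Faithful.of_comp_iso θ
  have : σ.Full := Functor.Full.of_comp_faithful_iso θ
  refine ⟨σ, ⟨inferInstance, inferInstance, ⟨fun R => ?_⟩⟩, ⟨θ⟩⟩
  obtain ⟨K, hK⟩ := hE.exists_retract hJ hfin hD R
  let θK : ∀ W : M, (W ⟶ σ.obj (op K)) ≃ₗ[k] ((E.obj W).obj K →ₗ[k] J) :=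
    fun W => ((θ.app (op K)).app (op W)).toLinearEquiv
  have hθ : ∀ {W W' : M} (f : W' ⟶ W) (h : W ⟶ σ.obj (op K)),
      θK W' (f ≫ h) = θK W h ∘ₗ lact E f K := fun f h =>
    LinearMap.congr_fun (congrArg ModuleCat.Hom.hom ((θ.hom.app (op K)).naturality f.op)) h
  obtain ⟨i, r, hir⟩ := hK (σ.obj (op K)) (θK _ (𝟙 _)) fun W φ => by
    refine ⟨(θK W).symm φ, ?_⟩
    have := hθ ((θK W).symm φ) (𝟙 _)
    rw [Category.comp_id, LinearEquiv.apply_symm_apply] at this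
    exact this.symm
  exact essImage_of_retract σ i r hir

end IsStableExt

end Bimodule

namespace Extriangulated

/-! ### Exact sequences in an extriangulated category -/

section Exact

variable {k : Type w} [CommRing k] {C : Type u} [Category.{v} C] [Preadditive C]
  [Linear k C] [HasBinaryBiproducts C] (T : Extriangulated k C)

/-- The map `E(c, A)`. -/
def pull {X Y : C} (c : X ⟶ Y) (A : C) :
    (T.E.obj (op Y)).obj A →ₗ[k] (T.E.obj (op X)).obj A := lact T.E c.op A

/-- The map `E(X, a)`. -/
def push (X : C) {A B : C} (a : A ⟶ B) :
    (T.E.obj (op X)).obj A →ₗ[k] (T.E.obj (op X)).obj B := ract T.E (op X) a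

@[simp]
theorem pull_id (X A : C) (e : (T.E.obj (op X)).obj A) : T.pull (𝟙 X) A e = e := lact_id T.E _ _ e

@[simp]
theorem push_id (X A : C) (e : (T.E.obj (op X)).obj A) : T.push X (𝟙 A) e = e := ract_id T.E _ _ e

theorem pull_comp {X Y Z : C} (c : X ⟶ Y) (d : Y ⟶ Z) (A : C) (e : (T.E.obj (op Z)).obj A) :
    T.pull (c ≫ d) A e = T.pull c A (T.pull d A e) := lact_comp T.E d.op c.op A e

theorem push_comp (X : C) {A B D : C} (a : A ⟶ B) (b : B ⟶ D) (e : (T.E.obj (op X)).obj A) :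
    T.push X (a ≫ b) e = T.push X b (T.push X a e) := ract_comp T.E _ a b e

theorem pull_push {X Y A B : C} (c : X ⟶ Y) (a : A ⟶ B) (e : (T.E.obj (op Y)).obj A) :
    T.pull c B (T.push Y a e) = T.push X a (T.pull c A e) := lact_ract T.E c.op a e

theorem pull_add {X Y : C} (c d : X ⟶ Y) (A : C) (e : (T.E.obj (op Y)).obj A) :
    T.pull (c + d) A e = T.pull c A e + T.pull d A e := by
  have := T.additive_left
  change ((T.E.map (c.op + d.op)).app A).hom e = _
  rw [Functor.map_add]
  rfl

theorem pull_smul {X Y : C} (r : k) (c : X ⟶ Y) (A : C) (e : (T.E.obj (op Y)).obj A) :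
    T.pull (r • c) A e = r • T.pull c A e := by
  change ((T.E.map (r • c).op).app A).hom e = _
  rw [T.linear_left]
  rfl

theorem push_add (X : C) {A B : C} (a b : A ⟶ B) (e : (T.E.obj (op X)).obj A) :
    T.push X (a + b) e = T.push X a e + T.push X b e := by
  have := T.additive_right (op X)
  change ((T.E.obj (op X)).map (a + b)).hom e = _
  rw [Functor.map_add]
  rfl

theorem push_smul (X : C) (r : k) {A B : C} (a : A ⟶ B) (e : (T.E.obj (op X)).obj A) :
    T.push X (r • a) e = r • T.push X a e := by
  have := T.additive_right (op X)
  have := T.linear_right (op X)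
  change ((T.E.obj (op X)).map (r • a)).hom e = _
  rw [Functor.map_smul]
  rfl

@[simp]
theorem pull_zero (X Y A : C) (e : (T.E.obj (op Y)).obj A) : T.pull (0 : X ⟶ Y) A e = 0 := by
  simpa using T.pull_smul (0 : k) (0 : X ⟶ Y) A e

@[simp]
theorem push_zero (X A B : C) (e : (T.E.obj (op X)).obj A) : T.push X (0 : A ⟶ B) e = 0 := by
  simpa using T.push_smul X (0 : k) (0 : A ⟶ B) e

theorem pull_sub {X Y : C} (c d : X ⟶ Y) (A : C) (e : (T.E.obj (op Y)).obj A) :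
    T.pull (c - d) A e = T.pull c A e - T.pull d A e := by
  rw [eq_sub_iff_add_eq, ← pull_add, sub_add_cancel]

theorem push_sub (X : C) {A B : C} (a b : A ⟶ B) (e : (T.E.obj (op X)).obj A) :
    T.push X (a - b) e = T.push X a e - T.push X b e := by
  rw [eq_sub_iff_add_eq, ← push_add, sub_add_cancel]

namespace IsTriangle

variable {T} {A B X : C} {x : A ⟶ B} {y : B ⟶ X} {δ : (T.E.obj (op X)).obj A}
  (h : T.IsTriangle x y δ)

include h

theorem comp_eq_zero : x ≫ y = 0 := by
  -- The pair (1, 0) is a morphism from the split extension to δ; any realization b of it satisfies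
  -- b ≫ y = 0.
  obtain ⟨b, hb₁, hb₂⟩ := T.realize_hom (T.triangle_zero A X) h (𝟙 A) 0
    ((map_zero _).trans (T.pull_zero X X A δ).symm)
  rw [Category.id_comp] at hb₁
  rw [← hb₁, Category.assoc, ← hb₂, comp_zero, comp_zero]

theorem push_eq_zero : T.push X x δ = 0 := by
  obtain ⟨c, -, hc⟩ := T.et3 h (T.triangle_zero B X) x biprod.inl rfl
  exact hc.trans (map_zero _)

theorem pull_eq_zero : T.pull y A δ = 0 := by
  obtain ⟨a, -, ha⟩ := T.et3_op (T.triangle_zero A B) h biprod.snd y rfl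
  exact ha.symm.trans (map_zero _)

theorem pull_eq_zero_iff {W : C} (c : W ⟶ X) : T.pull c A δ = 0 ↔ ∃ b : W ⟶ B, b ≫ y = c := by
  constructor
  · intro hc
    obtain ⟨b, -, hb⟩ := T.realize_hom (T.triangle_zero A W) h (𝟙 A) c ((map_zero _).trans hc.symm)
    exact ⟨biprod.inr ≫ b, by rw [Category.assoc, ← hb, biprod.inr_snd_assoc]⟩
  · rintro ⟨b, rfl⟩
    rw [pull_comp, h.pull_eq_zero, map_zero]

theorem push_eq_zero_iff {W : C} (a : A ⟶ W) : T.push X a δ = 0 ↔ ∃ b : B ⟶ W, x ≫ b = a := by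
  constructor
  · intro ha
    obtain ⟨b, hb, -⟩ := T.realize_hom h (T.triangle_zero W X) a (𝟙 X) (ha.trans (map_zero _).symm)
    exact ⟨b ≫ biprod.fst, by rw [← Category.assoc, hb, Category.assoc, biprod.inl_fst,
      Category.comp_id]⟩
  · rintro ⟨b, rfl⟩
    rw [push_comp, h.push_eq_zero, map_zero]

theorem exists_pull_eq {W : C} (e : (T.E.obj (op W)).obj A) (he : T.push W x e = 0) :
    ∃ c : W ⟶ X, T.pull c A δ = e := by
  obtain ⟨Y, g, g', hg⟩ := T.exists_triangle e
  obtain ⟨b, hb⟩ := (push_eq_zero_iff hg x).1 he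
  obtain ⟨c, -, hc⟩ := T.et3 hg h (𝟙 A) b (by rw [hb, Category.id_comp])
  exact ⟨c, hc.symm.trans (T.push_id _ _ _)⟩

theorem exists_push_eq {W : C} (e : (T.E.obj (op X)).obj W) (he : T.pull y W e = 0) :
    ∃ a : A ⟶ W, T.push X a δ = e := by
  obtain ⟨Y, g, g', hg⟩ := T.exists_triangle e
  obtain ⟨b, hb⟩ := (pull_eq_zero_iff hg y).1 he
  obtain ⟨a, -, ha⟩ := T.et3_op h hg b (𝟙 X) (by rw [hb, Category.comp_id])
  exact ⟨a, ha.trans (T.pull_id _ _ _)⟩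

/-- Exactness of E(W, A) → E(W, B) → E(W, X). (ET4), applied to x and the inflation of θ, gives a
triangle over W realizing the pushforward of θ along y. That extension is zero, so the triangle has
a section s, and pulling the extension of the composite inflation back along s gives θ'. -/
theorem exists_push_inflation_eq {W : C} (θ : (T.E.obj (op W)).obj B) (hθ : T.push W y θ = 0) :
    ∃ θ' : (T.E.obj (op W)).obj A, T.push W x θ' = θ := by
  obtain ⟨Y, g, g', hg⟩ := T.exists_triangle θ
  obtain ⟨Y', h', d, e, δ', -, -, -, hde, -, hδ'⟩ := T.et4 h hg
  obtain ⟨s, hs⟩ := (pull_eq_zero_iff hde (𝟙 W)).1 ((T.pull_id _ _ _).trans hθ)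
  refine ⟨T.pull s A δ', ?_⟩
  rw [← pull_push]
  refine (congrArg (T.pull s B) hδ').trans ?_
  exact (T.pull_comp s e B θ).symm.trans (by rw [hs, pull_id])

theorem exists_pull_deflation_eq {W : C} (θ : (T.E.obj (op B)).obj W) (hθ : T.pull x W θ = 0) :
    ∃ θ' : (T.E.obj (op X)).obj W, T.pull y W θ' = θ := by
  obtain ⟨Y, f', f, hf⟩ := T.exists_triangle θ
  obtain ⟨Y', d, e, h', δ', -, -, hde, -, -, hδ'⟩ := T.et4_op hf h
  obtain ⟨s, hs⟩ := (push_eq_zero_iff hde (𝟙 W)).1 ((T.push_id _ _ _).trans hθ)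
  refine ⟨T.push X s δ', ?_⟩
  rw [pull_push]
  refine (congrArg (T.push B s) hδ').symm.trans ?_
  exact (T.push_comp B d s θ).symm.trans (by rw [hs, push_id])

end IsTriangle

theorem eq_zero_of_proj {P A : C} (hP : T.proj P) (e : (T.E.obj (op P)).obj A) : e = 0 := by
  obtain ⟨B, x, y, h⟩ := T.exists_triangle e
  rw [← T.pull_id P A e]
  exact h.pull_eq_zero_iff (𝟙 P) |>.2 (hP ⟨_, _, _, x, y, e, h⟩ (𝟙 P))

theorem eq_zero_of_inj {X I : C} (hI : T.inj I) (e : (T.E.obj (op X)).obj I) : e = 0 := by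
  obtain ⟨B, x, y, h⟩ := T.exists_triangle e
  rw [← T.push_id X I e]
  exact h.push_eq_zero_iff (𝟙 I) |>.2 (hI ⟨_, _, _, x, y, e, h⟩ (𝟙 I))

theorem pull_eq_of_idealRel {X Y : C} {c d : X ⟶ Y} (h : idealRel T.proj c d) (A : C)
    (e : (T.E.obj (op Y)).obj A) : T.pull c A e = T.pull d A e := by
  obtain ⟨P, hP, a, b, hab⟩ := h
  rw [← sub_eq_zero, ← pull_sub, ← hab, pull_comp, T.eq_zero_of_proj hP (T.pull b A e), map_zero]

theorem push_eq_of_idealRel {A B : C} {a b : A ⟶ B} (h : idealRel T.inj a b) (X : C)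
    (e : (T.E.obj (op X)).obj A) : T.push X a e = T.push X b e := by
  obtain ⟨I, hI, c, d, hcd⟩ := h
  rw [← sub_eq_zero, ← push_sub, ← hcd, push_comp, T.eq_zero_of_inj hI (T.push X c e), map_zero]

end Exact

/-! ### Making morphisms into deflations and inflations -/

section Replace

variable {k : Type w} [CommRing k] {C : Type u} [Category.{v} C] [Preadditive C]
  [Linear k C] [HasBinaryBiproducts C] [HasZeroObject C] (T : Extriangulated k C)

/-- The map (f, p) is the composite of the deflations 1 ⊕ p : Y ⊞ P → Y ⊞ Z and (f, 1) : Y ⊞ Z → Z,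
so (ET4)ᵒᵖ applies. The second is a split deflation sheared by an automorphism of Y ⊞ Z. -/
theorem exists_isTriangle_desc {A P Y Z : C} (f : Y ⟶ Z) {x : A ⟶ P} {p : P ⟶ Z}
    {δ : (T.E.obj (op Z)).obj A} (h : T.IsTriangle x p δ) :
    ∃ (K : C) (i : K ⟶ Y ⊞ P) (ρ : (T.E.obj (op Z)).obj K),
      T.IsTriangle i (biprod.desc f p) ρ := by
  have h₁ := T.triangle_of_iso (y' := 𝟙 Y) (x' := (0 : (0 : C) ⟶ Y))
    ⟨biprod.snd, biprod.inr, by ext; simp, by simp⟩ (by simp) (by simp) (T.triangle_zero 0 Y)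
  have h₂ := T.triangle_biprod h₁ h
  have h₃ := T.triangle_of_iso (y' := biprod.desc f (𝟙 Z)) (x' := biprod.lift (𝟙 Y) (-f))
    ⟨biprod.lift biprod.fst (biprod.snd - biprod.fst ≫ f),
      biprod.lift biprod.fst (biprod.snd + biprod.fst ≫ f), by ext <;> simp, by ext <;> simp⟩
    (by ext <;> simp) (by ext <;> simp) (T.triangle_zero Y Z)
  obtain ⟨K, -, -, i, ρ, -, -, -, hi, -⟩ := T.et4_op h₂ h₃
  refine ⟨K, i, ρ, ?_⟩
  convert hi using 1
  ext <;> simp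

/-- Dual factorization: (f, 1) : Z → Y ⊞ Z, a sheared split inflation, followed by 1 ⊕ i. -/
theorem exists_isTriangle_lift {I B Y Z : C} (f : Z ⟶ Y) {i : Z ⟶ I} {p : I ⟶ B}
    {δ : (T.E.obj (op B)).obj Z} (h : T.IsTriangle i p δ) :
    ∃ (K : C) (q : Y ⊞ I ⟶ K) (ρ : (T.E.obj (op K)).obj Z),
      T.IsTriangle (biprod.lift f i) q ρ := by
  have h₁ := T.triangle_of_iso (y' := (0 : Y ⟶ (0 : C))) (x' := 𝟙 Y)
    ⟨biprod.fst, biprod.inl,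
      biprod.hom_ext _ _ (by simp) ((isZero_zero C).eq_of_tgt _ _), by simp⟩ (by simp)
    ((isZero_zero C).eq_of_tgt _ _) (T.triangle_zero Y 0)
  have h₂ := T.triangle_biprod h₁ h
  have h₃ := T.triangle_of_iso (x' := biprod.lift f (𝟙 Z)) (y' := biprod.desc (𝟙 Y) (-f))
    ⟨biprod.lift (biprod.snd + biprod.fst ≫ f) biprod.fst,
      biprod.lift biprod.snd (biprod.fst - biprod.snd ≫ f), by ext <;> simp, by ext <;> simp⟩
    (by ext <;> simp) (by ext <;> simp) (T.triangle_zero Z Y)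
  obtain ⟨K, q, -, -, ρ, -, -, hq, -⟩ := T.et4 h₃ h₂
  refine ⟨K, q, ρ, ?_⟩
  convert hq using 1
  ext <;> simp

end Replace

end Extriangulated

/-- Lets (C/[𝒫])ᵒᵖ serve as the covariantly acting category of a bimodule. -/
instance oppositeLinear {k : Type w} [CommRing k] {A : Type u} [Category.{v} A] [Preadditive A]
    [Linear k A] : Linear k Aᵒᵖ where
  homModule _ _ :=
    { smul := fun r f => (r • f.unop).op
      one_smul := fun f => Quiver.Hom.unop_inj (one_smul k f.unop)
      mul_smul := fun r s f => Quiver.Hom.unop_inj (mul_smul r s f.unop)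
      smul_zero := fun r => Quiver.Hom.unop_inj (smul_zero r)
      smul_add := fun r f g => Quiver.Hom.unop_inj (smul_add r f.unop g.unop)
      add_smul := fun r s f => Quiver.Hom.unop_inj (add_smul r s f.unop)
      zero_smul := fun f => Quiver.Hom.unop_inj (zero_smul k f.unop) }
  smul_comp X Y Z r f g := Quiver.Hom.unop_inj (Linear.comp_smul Z.unop Y.unop X.unop g.unop r f.unop)
  comp_smul X Y Z f r g := Quiver.Hom.unop_inj (Linear.smul_comp Z.unop Y.unop X.unop r g.unop f.unop)

namespace Extriangulated

variable {k : Type w} [CommRing k] {C : Type u} [Category.{v} C] [Preadditive C]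
  [Linear k C] [HasBinaryBiproducts C] [HasZeroObject C] (T : Extriangulated k C)

theorem toModProj_map_eq_iff {X Y : C} (f g : X ⟶ Y) :
    T.toModProj.map f = T.toModProj.map g ↔ idealRel T.proj f g :=
  Quotient.functor_map_eq_iff _ f g

theorem toModInj_map_eq_iff {X Y : C} (f g : X ⟶ Y) :
    T.toModInj.map f = T.toModInj.map g ↔ idealRel T.inj f g :=
  Quotient.functor_map_eq_iff _ f g

/-! ### The modules `E(-, X)` over `C/[𝒫]` -/

section Proj

/-- With p : P → Z a projective deflation, (f, p) is a deflation that agrees with f modulo [𝒫]. The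
cokernel of C/[𝒫](-, f) is thus the defect of a triangle and embeds in E(-, K). -/
theorem exists_pull_eq_zero_iff (hproj : T.EnoughProjectives) {Y Z : C} (f : Y ⟶ Z) :
    ∃ (K : C) (δ : (T.E.obj (op Z)).obj K), ∀ {V : C} (h : V ⟶ Z),
      T.pull h K δ = 0 ↔ ∃ g : V ⟶ Y, T.toModProj.map (g ≫ f) = T.toModProj.map h := by
  obtain ⟨A, P, x, p, δ, hP, hδ⟩ := hproj Z
  obtain ⟨K, i, ρ, hρ⟩ := T.exists_isTriangle_desc f hδ
  refine ⟨K, ρ, fun {V} h => (hρ.pull_eq_zero_iff h).trans ⟨?_, ?_⟩⟩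
  · rintro ⟨b, rfl⟩
    refine ⟨b ≫ biprod.fst, (T.toModProj_map_eq_iff _ _).2
      ⟨P, hP, b ≫ biprod.snd, -p, ?_⟩⟩
    rw [biprod.desc_eq, Preadditive.comp_add]
    simp
  · rintro ⟨g, hg⟩
    obtain ⟨P', hP', a, b, hab⟩ := (T.toModProj_map_eq_iff _ _).1 hg
    obtain ⟨l, hl⟩ := hP' ⟨_, _, _, _, _, _, hρ⟩ b
    refine ⟨g ≫ biprod.inl - a ≫ l, ?_⟩
    change l ≫ biprod.desc f p = b at hl
    rw [Preadditive.sub_comp, Category.assoc, Category.assoc, hl, hab, biprod.inl_desc]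
    abel

/-- Read off the long exact sequences of X → I → S with I injective: E(-, I) = 0, and a morphism out
of X that kills u factors through I. -/
theorem exists_pull_presentation (hinj : T.EnoughInjectives) (X : C) :
    ∃ (S I : C) (v : I ⟶ S) (u : (T.E.obj (op S)).obj X),
      (∀ (V : C) (e : (T.E.obj (op V)).obj X), ∃ h : V ⟶ S, T.pull h X u = e) ∧
      (∀ {V : C} (h : V ⟶ S), T.pull h X u = 0 ↔
        ∃ g : V ⟶ I, T.toModProj.map (g ≫ v) = T.toModProj.map h) ∧
      (∀ {Y : C} (u' : (T.E.obj (op S)).obj Y), T.pull v Y u' = 0 → ∃ b : X ⟶ Y,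
        T.push S b u = u') ∧
      (∀ {Y : C} (b b' : X ⟶ Y), T.push S b u = T.push S b' u →
        T.toModInj.map b = T.toModInj.map b') := by
  obtain ⟨I, S, x, y, u, hI, hu⟩ := hinj X
  refine ⟨S, I, y, u, fun V e => hu.exists_pull_eq e (T.eq_zero_of_inj hI _),
    fun h => ⟨fun hh => ?_, ?_⟩, fun u' hu' => hu.exists_push_eq u' hu', fun b b' hb => ?_⟩
  · obtain ⟨g, rfl⟩ := (hu.pull_eq_zero_iff h).1 hh
    exact ⟨g, rfl⟩
  · rintro ⟨g, hg⟩
    rw [← T.pull_eq_of_idealRel ((T.toModProj_map_eq_iff _ _).1 hg), pull_comp, hu.pull_eq_zero,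
      map_zero]
  · rw [← sub_eq_zero, ← push_sub] at hb
    obtain ⟨c, hc⟩ := (hu.push_eq_zero_iff _).1 hb
    exact (T.toModInj_map_eq_iff _ _).2 ⟨I, hI, x, c, hc⟩

theorem exists_pull_extension (hproj : T.EnoughProjectives) {S Y Z X : C} (g : S ⟶ Z) (f : Y ⟶ Z)
    (u : (T.E.obj (op S)).obj X)
    (hu : ∀ {V : C} (a : V ⟶ S) (b : V ⟶ Y),
      T.toModProj.map (a ≫ g + b ≫ f) = 0 → T.pull a X u = 0) :
    ∃ r : (T.E.obj (op Z)).obj X, T.pull g X r = u ∧ T.pull f X r = 0 := by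
  obtain ⟨A, P, x, p, δ, hP, hδ⟩ := hproj Z
  obtain ⟨K, i, ρ, hρ⟩ := T.exists_isTriangle_desc (biprod.desc g f) hδ
  have hi := hρ.comp_eq_zero
  -- Extend u by zero to S ⊞ Y ⊞ P. Its restriction to K vanishes by hypothesis, because the S- and
  -- Y-components of i composed with g and f add up to a morphism through P. So the extended element
  -- comes from E(Z, X).
  obtain ⟨r, hr⟩ := hρ.exists_pull_deflation_eq
    (T.pull (biprod.fst ≫ biprod.fst : (S ⊞ Y) ⊞ P ⟶ S) X u) (by
      rw [← pull_comp]
      refine hu _ (i ≫ biprod.fst ≫ biprod.snd) ?_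
      rw [← Functor.map_zero T.toModProj, toModProj_map_eq_iff]
      refine ⟨P, hP, i ≫ biprod.snd, -p, ?_⟩
      rw [biprod.desc_eq, biprod.desc_eq, Preadditive.comp_add, Preadditive.comp_add,
        Preadditive.comp_add] at hi
      simp only [Preadditive.comp_neg, Category.assoc, sub_zero]
      rw [neg_eq_iff_add_eq_zero, add_comm, ← hi])
  refine ⟨r, ?_, ?_⟩
  · have := congrArg (T.pull (biprod.inl ≫ biprod.inl : S ⟶ (S ⊞ Y) ⊞ P) X) hr
    rw [← pull_comp, ← pull_comp] at this
    simpa using this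
  · have := congrArg (T.pull (biprod.inr ≫ biprod.inl : Y ⟶ (S ⊞ Y) ⊞ P) X) hr
    rw [← pull_comp, ← pull_comp] at this
    simpa using this

end Proj

/-! ### The modules `E(X, -)` over `C/[ℐ]` -/

section Inj

/-- Dual device: adding an injective envelope-like summand i : Z → I makes f an inflation, unchanged
modulo [ℐ]. -/
theorem exists_push_eq_zero_iff (hinj : T.EnoughInjectives) {Z Y : C} (f : Z ⟶ Y) :
    ∃ (K : C) (δ : (T.E.obj (op K)).obj Z), ∀ {V : C} (h : Z ⟶ V),
      T.push K h δ = 0 ↔ ∃ g : Y ⟶ V, T.toModInj.map (f ≫ g) = T.toModInj.map h := by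
  obtain ⟨I, B, i, p, δ, hI, hδ⟩ := hinj Z
  obtain ⟨K, q, ρ, hρ⟩ := T.exists_isTriangle_lift f hδ
  refine ⟨K, ρ, fun {V} h => (hρ.push_eq_zero_iff h).trans ⟨?_, ?_⟩⟩
  · rintro ⟨b, rfl⟩
    refine ⟨biprod.inl ≫ b, (T.toModInj_map_eq_iff _ _).2
      ⟨I, hI, -i, biprod.inr ≫ b, ?_⟩⟩
    rw [biprod.lift_eq, Preadditive.add_comp]
    simp
  · rintro ⟨g, hg⟩
    obtain ⟨I', hI', a, b, hab⟩ := (T.toModInj_map_eq_iff _ _).1 hg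
    obtain ⟨l, hl⟩ := hI' ⟨_, _, _, _, _, _, hρ⟩ a
    refine ⟨biprod.fst ≫ g - l ≫ b, ?_⟩
    change biprod.lift f i ≫ l = a at hl
    rw [Preadditive.comp_sub, ← Category.assoc, ← Category.assoc, hl, hab, biprod.lift_fst]
    abel

theorem exists_push_presentation (hproj : T.EnoughProjectives) (X : C) :
    ∃ (S P : C) (v : S ⟶ P) (u : (T.E.obj (op X)).obj S),
      (∀ (V : C) (e : (T.E.obj (op X)).obj V), ∃ h : S ⟶ V, T.push X h u = e) ∧
      (∀ {V : C} (h : S ⟶ V), T.push X h u = 0 ↔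
        ∃ g : P ⟶ V, T.toModInj.map (v ≫ g) = T.toModInj.map h) ∧
      (∀ {Y : C} (u' : (T.E.obj (op Y)).obj S), T.push Y v u' = 0 → ∃ b : Y ⟶ X,
        T.pull b S u = u') ∧
      (∀ {Y : C} (b b' : Y ⟶ X), T.pull b S u = T.pull b' S u →
        T.toModProj.map b = T.toModProj.map b') := by
  obtain ⟨S, P, x, y, u, hP, hu⟩ := hproj X
  refine ⟨S, P, x, u, fun V e => hu.exists_push_eq e (T.eq_zero_of_proj hP _),
    fun h => ⟨fun hh => ?_, ?_⟩, fun u' hu' => hu.exists_pull_eq u' hu', fun b b' hb => ?_⟩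
  · obtain ⟨g, rfl⟩ := (hu.push_eq_zero_iff h).1 hh
    exact ⟨g, rfl⟩
  · rintro ⟨g, hg⟩
    rw [← T.push_eq_of_idealRel ((T.toModInj_map_eq_iff _ _).1 hg), push_comp, hu.push_eq_zero,
      map_zero]
  · rw [← sub_eq_zero, ← pull_sub] at hb
    obtain ⟨c, hc⟩ := (hu.pull_eq_zero_iff _).1 hb
    exact (T.toModProj_map_eq_iff _ _).2 ⟨P, hP, c, y, hc⟩

theorem exists_push_extension (hinj : T.EnoughInjectives) {Z S Y X : C} (g : Z ⟶ S) (f : Z ⟶ Y)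
    (u : (T.E.obj (op X)).obj S)
    (hu : ∀ {V : C} (a : S ⟶ V) (b : Y ⟶ V),
      T.toModInj.map (g ≫ a + f ≫ b) = 0 → T.push X a u = 0) :
    ∃ r : (T.E.obj (op X)).obj Z, T.push X g r = u ∧ T.push X f r = 0 := by
  obtain ⟨I, B, i, p, δ, hI, hδ⟩ := hinj Z
  obtain ⟨K, q, ρ, hρ⟩ := T.exists_isTriangle_lift (biprod.lift g f) hδ
  have hq := hρ.comp_eq_zero
  obtain ⟨r, hr⟩ := hρ.exists_push_inflation_eq
    (T.push X (biprod.inl ≫ biprod.inl : S ⟶ (S ⊞ Y) ⊞ I) u) (by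
      rw [← push_comp]
      refine hu _ (biprod.inr ≫ biprod.inl ≫ q) ?_
      rw [← Functor.map_zero T.toModInj, toModInj_map_eq_iff]
      refine ⟨I, hI, -i, biprod.inr ≫ q, ?_⟩
      rw [biprod.lift_eq, biprod.lift_eq, Preadditive.add_comp, Preadditive.add_comp,
        Preadditive.add_comp] at hq
      simp only [Preadditive.neg_comp, Category.assoc, sub_zero]
      rw [neg_eq_iff_add_eq_zero, add_comm, ← hq]
      simp)
  refine ⟨r, ?_, ?_⟩
  · have := congrArg (T.push X (biprod.fst ≫ biprod.fst : (S ⊞ Y) ⊞ I ⟶ S)) hr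
    rw [← push_comp, ← push_comp] at this
    simpa using this
  · have := congrArg (T.push X (biprod.fst ≫ biprod.snd : (S ⊞ Y) ⊞ I ⟶ Y)) hr
    rw [← push_comp, ← push_comp] at this
    simpa using this

end Inj

/-! ### The stable `Ext` bimodule -/

/-- The functor `E`, with the second variable in `C/[ℐ]`. -/
def extModInj : Cᵒᵖ ⥤ T.ModInj ⥤ ModuleCat.{v} k where
  obj X := CategoryTheory.Quotient.lift (idealRel T.inj) (T.E.obj X) fun _ _ _ _ h =>
    ModuleCat.hom_ext (LinearMap.ext fun e => T.push_eq_of_idealRel h X.unop e)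
  map f := Quotient.natTransLift _ (T.E.map f)
  map_id X := by
    refine NatTrans.ext (funext ?_)
    rintro ⟨Y⟩
    exact NatTrans.congr_app (T.E.map_id X) Y
  map_comp f g := by
    refine NatTrans.ext (funext ?_)
    rintro ⟨Y⟩
    exact NatTrans.congr_app (T.E.map_comp f g) Y

/-- The functor `E`, with the first variable in `C/[𝒫]` and the second one in `C/[ℐ]`. -/
def stableExt : T.ModProjᵒᵖ ⥤ T.ModInj ⥤ ModuleCat.{v} k :=
  (CategoryTheory.Quotient.lift (idealRel T.proj) T.extModInj.rightOp fun _ _ _ _ h =>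
    congrArg Quiver.Hom.op (NatTrans.ext (funext fun Y => ModuleCat.hom_ext (LinearMap.ext fun e =>
      T.pull_eq_of_idealRel h Y.as e)))).leftOp

theorem exists_toModProj_map {X Y : C} (f : T.toModProj.obj X ⟶ T.toModProj.obj Y) :
    ∃ c : X ⟶ Y, T.toModProj.map c = f := T.toModProj.map_surjective f

theorem exists_toModInj_map {X Y : C} (f : T.toModInj.obj X ⟶ T.toModInj.obj Y) :
    ∃ c : X ⟶ Y, T.toModInj.map c = f := T.toModInj.map_surjective f

theorem exists_op_toModProj_map {X Y : C}
    (f : op (T.toModProj.obj Y) ⟶ op (T.toModProj.obj X)) :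
    ∃ c : X ⟶ Y, (T.toModProj.map c).op = f := by
  obtain ⟨c, hc⟩ := T.toModProj.map_surjective f.unop
  exact ⟨c, Quiver.Hom.unop_inj hc⟩

theorem isStableExt_stableExt (hproj : T.EnoughProjectives) (hinj : T.EnoughInjectives) :
    IsStableExt T.stableExt where
  map_add := by
    rintro ⟨⟨S⟩⟩ ⟨⟨V⟩⟩ h g ⟨X⟩ e
    obtain ⟨h, rfl⟩ := T.exists_op_toModProj_map h
    obtain ⟨g, rfl⟩ := T.exists_op_toModProj_map g
    exact T.pull_add h g X e
  map_smul := by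
    rintro ⟨⟨S⟩⟩ ⟨⟨V⟩⟩ r h ⟨X⟩ e
    obtain ⟨h, rfl⟩ := T.exists_op_toModProj_map h
    exact T.pull_smul r h X e
  embeds := by
    rintro ⟨⟨Z⟩⟩ ⟨⟨Y⟩⟩ f
    obtain ⟨f, rfl⟩ := T.exists_op_toModProj_map f
    obtain ⟨K, δ, hδ⟩ := T.exists_pull_eq_zero_iff hproj f
    refine ⟨⟨K⟩, δ, ?_⟩
    rintro ⟨⟨V⟩⟩ h
    obtain ⟨h, rfl⟩ := T.exists_op_toModProj_map h
    refine (hδ h).trans ⟨?_, ?_⟩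
    · rintro ⟨g, hg⟩
      exact ⟨(T.toModProj.map g).op, Quiver.Hom.unop_inj hg⟩
    · rintro ⟨g, hg⟩
      obtain ⟨g, rfl⟩ := T.exists_op_toModProj_map g
      exact ⟨g, congrArg Quiver.Hom.unop hg⟩
  presented := by
    rintro ⟨X⟩
    obtain ⟨S, I, v, u, h₁, h₂, h₃, h₄⟩ := T.exists_pull_presentation hinj X
    refine ⟨⟨⟨S⟩⟩, ⟨⟨I⟩⟩, (T.toModProj.map v).op, u, ?_, ?_, ?_⟩
    · rintro ⟨⟨V⟩⟩ e
      obtain ⟨h, rfl⟩ := h₁ V e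
      exact ⟨(T.toModProj.map h).op, rfl⟩
    · rintro ⟨⟨V⟩⟩ h
      obtain ⟨h, rfl⟩ := T.exists_op_toModProj_map h
      refine (h₂ h).trans ⟨?_, ?_⟩
      · rintro ⟨g, hg⟩
        exact ⟨(T.toModProj.map g).op, Quiver.Hom.unop_inj hg⟩
      · rintro ⟨g, hg⟩
        obtain ⟨g, rfl⟩ := T.exists_op_toModProj_map g
        exact ⟨g, congrArg Quiver.Hom.unop hg⟩
    · rintro ⟨Y⟩ u' hu'
      obtain ⟨b, hb⟩ := h₃ u' hu'
      refine ⟨T.toModInj.map b, hb, fun b' hb' => ?_⟩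
      obtain ⟨b', rfl⟩ := T.exists_toModInj_map b'
      exact h₄ b' b (Eq.trans hb' hb.symm)
  extends_along := by
    rintro ⟨⟨Z⟩⟩ ⟨⟨S⟩⟩ ⟨⟨Y⟩⟩ g f ⟨X⟩ u hu
    obtain ⟨g, rfl⟩ := T.exists_op_toModProj_map g
    obtain ⟨f, rfl⟩ := T.exists_op_toModProj_map f
    refine T.exists_pull_extension hproj g f u fun {V} a b hab =>
      hu (T.toModProj.map a).op (T.toModProj.map b).op (Quiver.Hom.unop_inj ?_)
    rw [Functor.map_add, Functor.map_comp, Functor.map_comp] at hab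
    exact hab

theorem isStableExt_stableExt_flip (hproj : T.EnoughProjectives) (hinj : T.EnoughInjectives) :
    IsStableExt T.stableExt.flip where
  map_add := by
    rintro ⟨S⟩ ⟨V⟩ h g ⟨⟨X⟩⟩ e
    obtain ⟨h, rfl⟩ := T.exists_toModInj_map h
    obtain ⟨g, rfl⟩ := T.exists_toModInj_map g
    exact T.push_add X h g e
  map_smul := by
    rintro ⟨S⟩ ⟨V⟩ r h ⟨⟨X⟩⟩ e
    obtain ⟨h, rfl⟩ := T.exists_toModInj_map h
    exact T.push_smul X r h e
  embeds := by
    rintro ⟨Z⟩ ⟨Y⟩ f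
    obtain ⟨f, rfl⟩ := T.exists_toModInj_map f
    obtain ⟨K, δ, hδ⟩ := T.exists_push_eq_zero_iff hinj f
    refine ⟨⟨⟨K⟩⟩, δ, ?_⟩
    rintro ⟨V⟩ h
    obtain ⟨h, rfl⟩ := T.exists_toModInj_map h
    refine (hδ h).trans ⟨?_, ?_⟩
    · rintro ⟨g, hg⟩
      exact ⟨T.toModInj.map g, hg⟩
    · rintro ⟨g, hg⟩
      obtain ⟨g, rfl⟩ := T.exists_toModInj_map g
      exact ⟨g, hg⟩
  presented := by
    rintro ⟨⟨X⟩⟩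
    obtain ⟨S, I, v, u, h₁, h₂, h₃, h₄⟩ := T.exists_push_presentation hproj X
    refine ⟨⟨S⟩, ⟨I⟩, T.toModInj.map v, u, ?_, ?_, ?_⟩
    · rintro ⟨V⟩ e
      obtain ⟨h, rfl⟩ := h₁ V e
      exact ⟨T.toModInj.map h, rfl⟩
    · rintro ⟨V⟩ h
      obtain ⟨h, rfl⟩ := T.exists_toModInj_map h
      refine (h₂ h).trans ⟨?_, ?_⟩
      · rintro ⟨g, hg⟩
        exact ⟨T.toModInj.map g, hg⟩
      · rintro ⟨g, hg⟩
        obtain ⟨g, rfl⟩ := T.exists_toModInj_map g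
        exact ⟨g, hg⟩
    · rintro ⟨⟨Y⟩⟩ u' hu'
      obtain ⟨b, hb⟩ := h₃ u' hu'
      refine ⟨(T.toModProj.map b).op, hb, fun b' hb' => ?_⟩
      obtain ⟨b', rfl⟩ := T.exists_op_toModProj_map b'
      exact congrArg Quiver.Hom.op (h₄ b' b (Eq.trans hb' hb.symm))
  extends_along := by
    rintro ⟨Z⟩ ⟨S⟩ ⟨Y⟩ g f ⟨⟨X⟩⟩ u hu
    obtain ⟨g, rfl⟩ := T.exists_toModInj_map g
    obtain ⟨f, rfl⟩ := T.exists_toModInj_map f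
    refine T.exists_push_extension hinj g f u fun {V} a b hab =>
      hu (T.toModInj.map a) (T.toModInj.map b) ?_
    rw [Functor.map_add, Functor.map_comp, Functor.map_comp] at hab
    exact hab

end Extriangulated

/-! ### Cokernels of functors, and finitely presented modules in terms of elements -/

section Cokernel

variable {k : Type w} [CommRing k] {D : Type u} [Category.{v} D]

theorem cokernel_π_app_surjective {F G : D ⥤ ModuleCat.{v} k} (φ : F ⟶ G) (W : D) :
    Function.Surjective ((cokernel.π φ).app W).hom :=
  (ModuleCat.epi_iff_surjective _).1 inferInstance

theorem cokernel_π_app_eq_zero_iff {F G : D ⥤ ModuleCat.{v} k} (φ : F ⟶ G) (W : D) (x : G.obj W) :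
    ((cokernel.π φ).app W).hom x = 0 ↔ ∃ y, (φ.app W).hom y = x := by
  have h := (ShortComplex.exact_cokernel φ).map ((evaluation D (ModuleCat.{v} k)).obj W)
  rw [ShortComplex.moduleCat_exact_iff] at h
  refine ⟨h x, ?_⟩
  rintro ⟨y, rfl⟩
  exact LinearMap.congr_fun (congrArg ModuleCat.Hom.hom
    (NatTrans.congr_app (cokernel.condition φ) W)) y

/-- Two quotients of `H` with the same kernel are isomorphic. -/
theorem nonempty_iso_of_surjective {H F G : D ⥤ ModuleCat.{v} k} (p : H ⟶ F) (q : H ⟶ G)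
    (hp : ∀ W, Function.Surjective (p.app W).hom) (hq : ∀ W, Function.Surjective (q.app W).hom)
    (h : ∀ W x, (p.app W).hom x = 0 ↔ (q.app W).hom x = 0) : Nonempty (F ≅ G) := by
  let e : ∀ W, F.obj W ≃ₗ[k] G.obj W := fun W =>
    (LinearMap.quotKerEquivOfSurjective _ (hp W)).symm ≪≫ₗ
      Submodule.quotEquivOfEq _ _ (SetLike.ext (h W)) ≪≫ₗ
      LinearMap.quotKerEquivOfSurjective _ (hq W)
  have he : ∀ W x, e W ((p.app W).hom x) = (q.app W).hom x := fun W x => by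
    have : (LinearMap.quotKerEquivOfSurjective _ (hp W)).symm ((p.app W).hom x) =
        Submodule.Quotient.mk x := by
      rw [LinearEquiv.symm_apply_eq]; rfl
    simp only [e, LinearEquiv.trans_apply, this]
    rfl
  refine ⟨NatIso.ofComponents (fun W => (e W).toModuleIso) fun {W W'} f =>
    ModuleCat.hom_ext (LinearMap.ext fun y => ?_)⟩
  obtain ⟨x, rfl⟩ := hp W y
  have h1 : (F.map f).hom ((p.app W).hom x) = (p.app W').hom ((H.map f).hom x) :=
    (LinearMap.congr_fun (congrArg ModuleCat.Hom.hom (p.naturality f)) x).symm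
  have h2 : (G.map f).hom ((q.app W).hom x) = (q.app W').hom ((H.map f).hom x) :=
    (LinearMap.congr_fun (congrArg ModuleCat.Hom.hom (q.naturality f)) x).symm
  change e W' ((F.map f).hom ((p.app W).hom x)) = (G.map f).hom (e W ((p.app W).hom x))
  rw [h1, he, he, h2]

end Cokernel

section FinPres

variable {k : Type w} [CommRing k] {A : Type u} [Category.{v} A] [Preadditive A] [Linear k A]

theorem isFinPresRight_of_surjective {F : Aᵒᵖ ⥤ ModuleCat.{v} k} {X Y : A} (f : X ⟶ Y)
    (p : (linearYoneda k A).obj Y ⟶ F) (hp : ∀ W, Function.Surjective (p.app W).hom)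
    (hf : ∀ (W : A) (h : W ⟶ Y), (p.app (op W)).hom h = 0 ↔ ∃ g : W ⟶ X, g ≫ f = h) :
    IsFinPresRight k A F :=
  ⟨X, Y, f, nonempty_iso_of_surjective p (cokernel.π _) hp (cokernel_π_app_surjective _)
    fun W h => (hf W.unop h).trans (cokernel_π_app_eq_zero_iff ((linearYoneda k A).map f) W h).symm⟩

theorem isFinPresLeft_of_surjective {F : A ⥤ ModuleCat.{v} k} {X Y : A} (f : X ⟶ Y)
    (p : (linearCoyoneda k A).obj (op X) ⟶ F) (hp : ∀ W, Function.Surjective (p.app W).hom)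
    (hf : ∀ (W : A) (h : X ⟶ W), (p.app W).hom h = 0 ↔ ∃ g : Y ⟶ W, f ≫ g = h) :
    IsFinPresLeft k A F :=
  ⟨X, Y, f, nonempty_iso_of_surjective p (cokernel.π _) hp (cokernel_π_app_surjective _)
    fun W h => (hf W h).trans (cokernel_π_app_eq_zero_iff ((linearCoyoneda k A).map f.op) W h).symm⟩

theorem IsFinPresRight.exists_surjective {F : Aᵒᵖ ⥤ ModuleCat.{v} k} (hF : IsFinPresRight k A F) :
    ∃ (X Y : A) (f : X ⟶ Y) (y : F.obj (op Y)),
      (∀ (W : A) (x : F.obj (op W)), ∃ h : W ⟶ Y, (F.map h.op).hom y = x) ∧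
      ∀ (W : A) (h : W ⟶ Y), (F.map h.op).hom y = 0 ↔ ∃ g : W ⟶ X, g ≫ f = h := by
  obtain ⟨X, Y, f, ⟨e⟩⟩ := hF
  let p : (linearYoneda k A).obj Y ⟶ F := cokernel.π _ ≫ e.inv
  have hp : ∀ (W : A) (h : W ⟶ Y),
      (F.map h.op).hom ((p.app (op Y)).hom (𝟙 Y)) = (p.app (op W)).hom h := fun W h => by
    have := LinearMap.congr_fun (congrArg ModuleCat.Hom.hom (p.naturality h.op)) (𝟙 Y)
    refine this.symm.trans (congrArg (p.app (op W)).hom ?_)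
    exact Category.comp_id h
  let e' : ∀ W, (cokernel ((linearYoneda k A).map f)).obj W ≃ₗ[k] F.obj W :=
    fun W => (e.symm.app W).toLinearEquiv
  refine ⟨X, Y, f, (p.app (op Y)).hom (𝟙 Y), fun W x => ?_, fun W h => ?_⟩
  · obtain ⟨h, hh⟩ := cokernel_π_app_surjective ((linearYoneda k A).map f) (op W) ((e' _).symm x)
    refine ⟨h, (hp W h).trans ?_⟩
    change e' (op W) (((cokernel.π ((linearYoneda k A).map f)).app (op W)).hom h) = x
    rw [hh, LinearEquiv.apply_symm_apply]
  · rw [hp]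
    change e' (op W) (((cokernel.π ((linearYoneda k A).map f)).app (op W)).hom h) = 0 ↔ _
    rw [LinearEquiv.map_eq_zero_iff]
    exact cokernel_π_app_eq_zero_iff ((linearYoneda k A).map f) (op W) h

theorem IsFinPresLeft.exists_surjective {F : A ⥤ ModuleCat.{v} k} (hF : IsFinPresLeft k A F) :
    ∃ (X Y : A) (f : X ⟶ Y) (y : F.obj X),
      (∀ (W : A) (x : F.obj W), ∃ h : X ⟶ W, (F.map h).hom y = x) ∧
      ∀ (W : A) (h : X ⟶ W), (F.map h).hom y = 0 ↔ ∃ g : Y ⟶ W, f ≫ g = h := by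
  obtain ⟨X, Y, f, ⟨e⟩⟩ := hF
  let p : (linearCoyoneda k A).obj (op X) ⟶ F := cokernel.π _ ≫ e.inv
  have hp : ∀ (W : A) (h : X ⟶ W),
      (F.map h).hom ((p.app X).hom (𝟙 X)) = (p.app W).hom h := fun W h => by
    have := LinearMap.congr_fun (congrArg ModuleCat.Hom.hom (p.naturality h)) (𝟙 X)
    refine this.symm.trans (congrArg (p.app W).hom ?_)
    exact Category.id_comp h
  let e' : ∀ W, (cokernel ((linearCoyoneda k A).map f.op)).obj W ≃ₗ[k] F.obj W :=
    fun W => (e.symm.app W).toLinearEquiv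
  refine ⟨X, Y, f, (p.app X).hom (𝟙 X), fun W x => ?_, fun W h => ?_⟩
  · obtain ⟨h, hh⟩ := cokernel_π_app_surjective ((linearCoyoneda k A).map f.op) W ((e' _).symm x)
    refine ⟨h, (hp W h).trans ?_⟩
    change e' W (((cokernel.π ((linearCoyoneda k A).map f.op)).app W).hom h) = x
    rw [hh, LinearEquiv.apply_symm_apply]
  · rw [hp]
    change e' W (((cokernel.π ((linearCoyoneda k A).map f.op)).app W).hom h) = 0 ↔ _
    rw [LinearEquiv.map_eq_zero_iff]
    exact cokernel_π_app_eq_zero_iff ((linearCoyoneda k A).map f.op) W h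

theorem isFinPresRight_linearYoneda [HasZeroObject A] (V : A) :
    IsFinPresRight k A ((linearYoneda k A).obj V) :=
  isFinPresRight_of_surjective (0 : (0 : A) ⟶ V) (𝟙 _) (fun _ x => ⟨x, rfl⟩) fun _ _ =>
    ⟨fun hh => ⟨0, comp_zero.trans (Eq.symm hh)⟩, fun ⟨_, hg⟩ => hg.symm.trans comp_zero⟩

theorem isFinPresLeft_linearCoyoneda [HasZeroObject A] (V : A) :
    IsFinPresLeft k A ((linearCoyoneda k A).obj (op V)) :=
  isFinPresLeft_of_surjective (0 : V ⟶ (0 : A)) (𝟙 _) (fun _ x => ⟨x, rfl⟩) fun _ _ =>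
    ⟨fun hh => ⟨0, zero_comp.trans (Eq.symm hh)⟩, fun ⟨_, hg⟩ => hg.symm.trans zero_comp⟩

end FinPres

/-! ### Dualizing varieties and the modules of a stable Ext bimodule -/

section Variety

variable {k : Type w} [CommRing k] {A : Type u} [Category.{v} A] [Preadditive A] [Linear k A]

/-- The linear version of `Quiver.Hom.unop`. -/
def unopLinearEquiv (X Y : Aᵒᵖ) : (X ⟶ Y) ≃ₗ[k] (Y.unop ⟶ X.unop) where
  toFun f := f.unop
  invFun f := f.op
  map_add' _ _ := rfl
  map_smul' _ _ := rfl

variable {J : Type v} [AddCommGroup J] [Module k J] {N : Type u} [Category.{v} N]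

theorem IsDualizingVariety.isDualizingFor (hA : IsDualizingVariety k A J)
    {E : A ⥤ N ⥤ ModuleCat.{v} k} (hE : IsStableExt E) : IsDualizingFor E J where
  generator X := by
    obtain ⟨S, I, v, u, h₁, h₂, -⟩ := hE.presented X
    let p : (linearCoyoneda k A).obj (op S) ⟶ E.flip.obj X :=
      { app := fun W => ModuleCat.ofHom (hE.orbit u W)
        naturality := fun W W' f => ModuleCat.hom_ext (LinearMap.ext fun h =>
          lact_comp E h f X u) }
    -- E(-, X) is finitely presented by `presented`, so its dual is finitely presented too and has a
    -- single generator q.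
    obtain ⟨-, V, -, q, hq, -⟩ := (hA.dual_left _ (isFinPresLeft_of_surjective v p
      (fun W => h₁ W) fun W h => h₂ h)).exists_surjective
    refine ⟨V, q, fun {W} φ => ?_⟩
    obtain ⟨h, hh⟩ := hq W φ
    exact ⟨h, fun e => (LinearMap.congr_fun hh e).symm⟩
  presentation V := by
    have := hA.hasFiniteBiproducts
    have := hasZeroObject_of_hasFiniteBiproducts A
    obtain ⟨Z, Y, f, z, h₁, h₂⟩ := (hA.dual_right _
      (isFinPresRight_linearYoneda V)).exists_surjective
    refine ⟨Z, Y, f, z, fun {W} α => ?_, fun g => ?_, fun {W} h hh => ?_⟩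
    · obtain ⟨h, hh⟩ := h₁ W α
      exact ⟨h, fun x => (LinearMap.congr_fun hh x).symm⟩
    · exact LinearMap.congr_fun ((h₂ Y f).2 ⟨𝟙 Y, Category.comp_id f⟩) g
    · exact (h₂ W h).1 (LinearMap.ext hh)

/-- The version of `IsDualizingVariety.isDualizingFor` for bimodules contravariant in `A`. -/
theorem IsDualizingVariety.isDualizingFor_op (hA : IsDualizingVariety k A J)
    {E : Aᵒᵖ ⥤ N ⥤ ModuleCat.{v} k} (hE : IsStableExt E) : IsDualizingFor E J where
  generator X := by
    obtain ⟨S, I, v, u, h₁, h₂, -⟩ := hE.presented X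
    let p : (linearYoneda k A).obj S.unop ⟶ E.flip.obj X :=
      { app := fun W => ModuleCat.ofHom (hE.orbit u W ∘ₗ (unopLinearEquiv S W).symm.toLinearMap)
        naturality := fun W W' f => ModuleCat.hom_ext (LinearMap.ext fun h =>
          lact_comp E (unopLinearEquiv (k := k) S W |>.symm h) f X u) }
    have hF : IsFinPresRight k A (E.flip.obj X) := by
      refine isFinPresRight_of_surjective v.unop p (fun W e => ?_) fun W h => ?_
      · obtain ⟨h, hh⟩ := h₁ W e
        exact ⟨h.unop, hh⟩
      · refine (h₂ h.op).trans ⟨?_, ?_⟩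
        · rintro ⟨g, hg⟩
          exact ⟨g.unop, congrArg Quiver.Hom.unop hg⟩
        · rintro ⟨g, hg⟩
          exact ⟨g.op, congrArg Quiver.Hom.op hg⟩
    obtain ⟨V, -, -, q, hq, -⟩ := (hA.dual_right _ hF).exists_surjective
    refine ⟨op V, q, fun {W} φ => ?_⟩
    obtain ⟨h, hh⟩ := hq W.unop φ
    exact ⟨h.op, fun e => (LinearMap.congr_fun hh e).symm⟩
  presentation V := by
    have := hA.hasFiniteBiproducts
    have := hasZeroObject_of_hasFiniteBiproducts A
    obtain ⟨Y, Z, f, z, h₁, h₂⟩ := (hA.dual_left _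
      (isFinPresLeft_linearCoyoneda V.unop)).exists_surjective
    let z' : (V.unop ⟶ Z) →ₗ[k] J := z
    refine ⟨op Z, op Y, f.op, z' ∘ₗ (unopLinearEquiv (op Z) V).toLinearMap,
      fun {W} α => ?_, fun g => ?_, fun {W} h hh => ?_⟩
    · obtain ⟨h, hh⟩ := h₁ W.unop (α ∘ₗ (unopLinearEquiv W V).symm.toLinearMap)
      exact ⟨h.op, fun x => (LinearMap.congr_fun hh x.unop).symm⟩
    · exact LinearMap.congr_fun ((h₂ Y f).2 ⟨𝟙 Y, Category.id_comp f⟩) g.unop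
    · obtain ⟨g, hg⟩ := (h₂ W.unop h.unop).1 (LinearMap.ext fun x => hh x.op)
      exact ⟨g.op, Quiver.Hom.unop_inj hg⟩

end Variety

/-! ### The defects of a triangle -/

namespace Extriangulated.Triangle

variable {k : Type w} [CommRing k] {C : Type u} [Category.{v} C] [Preadditive C]
  [Linear k C] [HasBinaryBiproducts C] [HasZeroObject C] {T : Extriangulated k C}
  (t : T.Triangle)

/-- The class in `δ_*` of a morphism out of `X₁`. -/
noncomputable def covClass (V : C) : (t.X₁ ⟶ V) →ₗ[k] t.covDefect.obj V :=
  ((cokernel.π ((linearCoyoneda k C).map t.f₁.op)).app V).hom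

theorem covClass_surjective (V : C) : Function.Surjective (t.covClass V) :=
  cokernel_π_app_surjective _ V

theorem covClass_eq_zero_iff {V : C} (a : t.X₁ ⟶ V) :
    t.covClass V a = 0 ↔ ∃ b : t.X₂ ⟶ V, t.f₁ ≫ b = a :=
  cokernel_π_app_eq_zero_iff ((linearCoyoneda k C).map t.f₁.op) V a

theorem covDefect_map_covClass {V W : C} (a : t.X₁ ⟶ V) (b : V ⟶ W) :
    (t.covDefect.map b).hom (t.covClass V a) = t.covClass W (a ≫ b) :=
  (LinearMap.congr_fun (congrArg ModuleCat.Hom.hom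
    ((cokernel.π ((linearCoyoneda k C).map t.f₁.op)).naturality b)) a).symm

/-- The class in `δ^*` of a morphism to `X₃`. -/
noncomputable def contraClass (V : C) : (V ⟶ t.X₃) →ₗ[k] t.contraDefect.obj (op V) :=
  ((cokernel.π ((linearYoneda k C).map t.f₂)).app (op V)).hom

theorem contraClass_surjective (V : C) : Function.Surjective (t.contraClass V) :=
  cokernel_π_app_surjective _ (op V)

theorem contraClass_eq_zero_iff {V : C} (a : V ⟶ t.X₃) :
    t.contraClass V a = 0 ↔ ∃ b : V ⟶ t.X₂, b ≫ t.f₂ = a :=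
  cokernel_π_app_eq_zero_iff ((linearYoneda k C).map t.f₂) (op V) a

theorem contraDefect_map_contraClass {V W : C} (a : V ⟶ t.X₃) (b : W ⟶ V) :
    (t.contraDefect.map b.op).hom (t.contraClass V a) = t.contraClass W (b ≫ a) :=
  (LinearMap.congr_fun (congrArg ModuleCat.Hom.hom
    ((cokernel.π ((linearYoneda k C).map t.f₂)).naturality b.op)) a).symm

/-- `δ_*` as a quotient of a representable module over `C/[ℐ]`. -/
noncomputable def covProj :
    (linearCoyoneda k T.ModInj).obj (op (T.toModInj.obj t.X₁)) ⟶ t.covDefectModInj where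
  app V := ModuleCat.ofHom
    { toFun := fun h => (t.covDefectModInj.map h).hom (t.covClass t.X₁ (𝟙 t.X₁))
      map_add' := fun h g => by
        obtain ⟨V⟩ := V
        obtain ⟨h, rfl⟩ := T.exists_toModInj_map h
        obtain ⟨g, rfl⟩ := T.exists_toModInj_map g
        rw [← Functor.map_add]
        change (t.covDefect.map (h + g)).hom _ =
          (t.covDefect.map h).hom _ + (t.covDefect.map g).hom _
        simp only [covDefect_map_covClass, Category.id_comp, map_add]
      map_smul' := fun r h => by
        obtain ⟨V⟩ := V
        obtain ⟨h, rfl⟩ := T.exists_toModInj_map h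
        change (t.covDefect.map (r • h)).hom _ = r • (t.covDefect.map h).hom _
        simp only [covDefect_map_covClass, Category.id_comp, map_smul] }
  naturality V W f := ModuleCat.hom_ext (LinearMap.ext fun h =>
    LinearMap.congr_fun (congrArg ModuleCat.Hom.hom (t.covDefectModInj.map_comp _ f)) _)

theorem covProj_app {V : C} (a : t.X₁ ⟶ V) :
    (t.covProj.app (T.toModInj.obj V)).hom (T.toModInj.map a) = t.covClass V a :=
  (t.covDefect_map_covClass (𝟙 _) a).trans (by rw [Category.id_comp])

theorem covProj_surjective (V : T.ModInj) : Function.Surjective (t.covProj.app V).hom := by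
  obtain ⟨V⟩ := V
  intro z
  obtain ⟨a, rfl⟩ := t.covClass_surjective V z
  exact ⟨T.toModInj.map a, t.covProj_app a⟩

theorem covProj_eq_zero_iff {V : T.ModInj} (h : T.toModInj.obj t.X₁ ⟶ V) :
    (t.covProj.app V).hom h = 0 ↔
      ∃ g : T.toModInj.obj t.X₂ ⟶ V, T.toModInj.map t.f₁ ≫ g = h := by
  obtain ⟨V⟩ := V
  obtain ⟨h, rfl⟩ := T.exists_toModInj_map h
  constructor
  · intro hh
    obtain ⟨b, rfl⟩ := (t.covClass_eq_zero_iff h).1 ((t.covProj_app h).symm.trans hh)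
    exact ⟨T.toModInj.map b, (T.toModInj.map_comp _ _).symm⟩
  · rintro ⟨g, hg⟩
    obtain ⟨g, rfl⟩ := T.exists_toModInj_map g
    rw [← hg, ← Functor.map_comp]
    exact (t.covProj_app _).trans ((t.covClass_eq_zero_iff _).2 ⟨g, rfl⟩)

/-- `δ^*` as a quotient of a representable module over `C/[𝒫]`. -/
noncomputable def contraProj :
    (linearYoneda k T.ModProj).obj (T.toModProj.obj t.X₃) ⟶ t.contraDefectModProj where
  app V := ModuleCat.ofHom
    { toFun := fun (h : V.unop ⟶ T.toModProj.obj t.X₃) =>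
        (t.contraDefectModProj.map h.op).hom (t.contraClass t.X₃ (𝟙 t.X₃))
      map_add' := fun h g => by
        obtain ⟨⟨V⟩⟩ := V
        obtain ⟨h, rfl⟩ := T.exists_toModProj_map h
        obtain ⟨g, rfl⟩ := T.exists_toModProj_map g
        rw [← Functor.map_add]
        change (t.contraDefect.map (h + g).op).hom _ =
          (t.contraDefect.map h.op).hom _ + (t.contraDefect.map g.op).hom _
        simp only [contraDefect_map_contraClass, Category.comp_id, map_add]
      map_smul' := fun r h => by
        obtain ⟨⟨V⟩⟩ := V
        obtain ⟨h, rfl⟩ := T.exists_toModProj_map h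
        change (t.contraDefect.map (r • h).op).hom _ = r • (t.contraDefect.map h.op).hom _
        simp only [contraDefect_map_contraClass, Category.comp_id, map_smul] }
  naturality V W f := ModuleCat.hom_ext (LinearMap.ext fun h =>
    LinearMap.congr_fun (congrArg ModuleCat.Hom.hom
      (t.contraDefectModProj.map_comp (Quiver.Hom.op h) f)) _)

theorem contraProj_app {V : C} (a : V ⟶ t.X₃) :
    (t.contraProj.app (op (T.toModProj.obj V))).hom (T.toModProj.map a) = t.contraClass V a :=
  (t.contraDefect_map_contraClass (𝟙 _) a).trans (by rw [Category.comp_id])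

theorem contraProj_surjective (V : T.ModProjᵒᵖ) :
    Function.Surjective (t.contraProj.app V).hom := by
  obtain ⟨⟨V⟩⟩ := V
  intro z
  obtain ⟨a, rfl⟩ := t.contraClass_surjective V z
  exact ⟨T.toModProj.map a, t.contraProj_app a⟩

theorem contraProj_eq_zero_iff {V : T.ModProj} (h : V ⟶ T.toModProj.obj t.X₃) :
    (t.contraProj.app (op V)).hom h = 0 ↔
      ∃ g : V ⟶ T.toModProj.obj t.X₂, g ≫ T.toModProj.map t.f₂ = h := by
  obtain ⟨V⟩ := V
  obtain ⟨h, rfl⟩ := T.exists_toModProj_map h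
  constructor
  · intro hh
    obtain ⟨b, rfl⟩ := (t.contraClass_eq_zero_iff h).1 ((t.contraProj_app h).symm.trans hh)
    exact ⟨T.toModProj.map b, (T.toModProj.map_comp _ _).symm⟩
  · rintro ⟨g, hg⟩
    obtain ⟨g, rfl⟩ := T.exists_toModProj_map g
    rw [← hg, ← Functor.map_comp]
    exact (t.contraProj_app _).trans ((t.contraClass_eq_zero_iff _).2 ⟨g, rfl⟩)

/-- The embedding of `δ_*` into `E(X₃, -)`. -/
noncomputable def covIncl : t.covDefectModInj ⟶ T.stableExt.obj (op (T.toModProj.obj t.X₃)) :=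
  Quotient.natTransLift _ (F := t.covDefectModInj)
    (G := T.stableExt.obj (op (T.toModProj.obj t.X₃)))
    (cokernel.desc ((linearCoyoneda k C).map t.f₁.op) (W := T.E.obj (op t.X₃))
      { app := fun V => ModuleCat.ofHom
          { toFun := fun (a : t.X₁ ⟶ V) => T.push t.X₃ a t.ρ
            map_add' := fun a b => T.push_add _ a b _
            map_smul' := fun r a => T.push_smul _ r a _ }
        naturality := fun _ _ f => ModuleCat.hom_ext (LinearMap.ext fun a =>
          T.push_comp t.X₃ a f t.ρ) }
      (NatTrans.ext (funext fun _ => ModuleCat.hom_ext (LinearMap.ext fun b =>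
        (t.isTriangle.push_eq_zero_iff _).2 ⟨b, rfl⟩))))

theorem covIncl_app {V : C} (a : t.X₁ ⟶ V) :
    (t.covIncl.app (T.toModInj.obj V)).hom (t.covClass V a) = T.push t.X₃ a t.ρ :=
  LinearMap.congr_fun (congrArg ModuleCat.Hom.hom
    (NatTrans.congr_app (cokernel.π_desc ((linearCoyoneda k C).map t.f₁.op) _ _) V)) a

theorem covIncl_injective (V : T.ModInj) : Function.Injective (t.covIncl.app V).hom := by
  obtain ⟨V⟩ := V
  rw [injective_iff_map_eq_zero]
  intro z hz
  obtain ⟨a, rfl⟩ := t.covClass_surjective V z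
  exact (t.covClass_eq_zero_iff a).2
    ((t.isTriangle.push_eq_zero_iff a).1 ((t.covIncl_app a).symm.trans hz))

/-- With `covIncl_injective`, this is exactness of 0 → δ_* → E(X₃, -) → E(X₂, -). -/
theorem exists_covIncl_eq_iff {V : T.ModInj}
    (e : (T.stableExt.obj (op (T.toModProj.obj t.X₃))).obj V) :
    (∃ z, (t.covIncl.app V).hom z = e) ↔
      lact T.stableExt (T.toModProj.map t.f₂).op V e = 0 := by
  obtain ⟨V⟩ := V
  constructor
  · rintro ⟨z, rfl⟩
    obtain ⟨a, rfl⟩ := t.covClass_surjective V z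
    refine (congrArg (T.pull t.f₂ V) (t.covIncl_app a)).trans ?_
    rw [pull_push, t.isTriangle.pull_eq_zero, map_zero]
    rfl
  · intro he
    obtain ⟨a, rfl⟩ := t.isTriangle.exists_push_eq e he
    exact ⟨t.covClass V a, t.covIncl_app a⟩

/-- The embedding of `δ^*` into `E(-, X₁)`. -/
noncomputable def contraIncl :
    t.contraDefectModProj ⟶ T.stableExt.flip.obj (T.toModInj.obj t.X₁) where
  app V := (cokernel.desc ((linearYoneda k C).map t.f₂) (W := T.E.flip.obj t.X₁)
      { app := fun V => ModuleCat.ofHom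
          { toFun := fun (a : V.unop ⟶ t.X₃) => T.pull a t.X₁ t.ρ
            map_add' := fun a b => T.pull_add a b _ _
            map_smul' := fun r a => T.pull_smul r a _ _ }
        naturality := fun _ _ f => ModuleCat.hom_ext (LinearMap.ext fun a =>
          T.pull_comp f.unop a t.X₁ t.ρ) }
      (NatTrans.ext (funext fun _ => ModuleCat.hom_ext (LinearMap.ext fun b =>
        (t.isTriangle.pull_eq_zero_iff _).2 ⟨b, rfl⟩)))).app (op V.unop.as)
  naturality := by
    rintro ⟨⟨V⟩⟩ ⟨⟨W⟩⟩ f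
    obtain ⟨f, rfl⟩ := T.exists_op_toModProj_map f
    exact NatTrans.naturality _ f.op

theorem contraIncl_app {V : C} (a : V ⟶ t.X₃) :
    (t.contraIncl.app (op (T.toModProj.obj V))).hom (t.contraClass V a) = T.pull a t.X₁ t.ρ :=
  LinearMap.congr_fun (congrArg ModuleCat.Hom.hom
    (NatTrans.congr_app (cokernel.π_desc ((linearYoneda k C).map t.f₂) _ _) (op V))) a

theorem contraIncl_injective (V : T.ModProjᵒᵖ) :
    Function.Injective (t.contraIncl.app V).hom := by
  obtain ⟨⟨V⟩⟩ := V
  rw [injective_iff_map_eq_zero]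
  intro z hz
  obtain ⟨a, rfl⟩ := t.contraClass_surjective V z
  exact (t.contraClass_eq_zero_iff a).2
    ((t.isTriangle.pull_eq_zero_iff a).1 ((t.contraIncl_app a).symm.trans hz))

theorem exists_contraIncl_eq_iff {V : T.ModProjᵒᵖ}
    (e : (T.stableExt.obj V).obj (T.toModInj.obj t.X₁)) :
    (∃ z, (t.contraIncl.app V).hom z = e) ↔
      ract T.stableExt V (T.toModInj.map t.f₁) e = 0 := by
  obtain ⟨⟨V⟩⟩ := V
  constructor
  · rintro ⟨z, rfl⟩
    obtain ⟨a, rfl⟩ := t.contraClass_surjective V z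
    refine (congrArg (T.push V t.f₁) (t.contraIncl_app a)).trans ?_
    rw [← pull_push, t.isTriangle.push_eq_zero, map_zero]
    rfl
  · intro he
    obtain ⟨a, rfl⟩ := t.isTriangle.exists_pull_eq e he
    exact ⟨t.contraClass V a, t.contraIncl_app a⟩

end Extriangulated.Triangle

/-! ### Auslander–Reiten duality -/

section

variable {k : Type w} [CommRing k] {A B : Type u} [Category.{v} A] [Category.{v} B]
  [Preadditive A] [Linear k A] [Preadditive B] [Linear k B]

/-- The Auslander–Reiten formulas `A(τ⁻¹ V, W) ≅ D E(W, V) ≅ B(V, τ W)`. -/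
structure ARFormula (E : Aᵒᵖ ⥤ B ⥤ ModuleCat.{v} k) (J : Type v) [AddCommGroup J] [Module k J]
    (τ : A ≌ B) where
  /-- the isomorphism `A(τ⁻¹ V, W) ≅ D E(W, V)` -/
  left : ∀ (W : A) (V : B), (τ.inverse.obj V ⟶ W) ≃ₗ[k] ((E.obj (op W)).obj V →ₗ[k] J)
  left_comp : ∀ {W W' : A} {V : B} (f : τ.inverse.obj V ⟶ W) (c : W ⟶ W'),
    left W' V (f ≫ c) = left W V f ∘ₗ lact E c.op V
  left_map_comp : ∀ {W : A} {V V' : B} (b : V ⟶ V') (f : τ.inverse.obj V' ⟶ W),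
    left W V (τ.inverse.map b ≫ f) = left W V' f ∘ₗ ract E (op W) b
  /-- the isomorphism `B(V, τ W) ≅ D E(W, V)` -/
  right : ∀ (W : A) (V : B), (V ⟶ τ.functor.obj W) ≃ₗ[k] ((E.obj (op W)).obj V →ₗ[k] J)
  right_comp_map : ∀ {W W' : A} {V : B} (g : V ⟶ τ.functor.obj W) (c : W ⟶ W'),
    right W' V (g ≫ τ.functor.map c) = right W V g ∘ₗ lact E c.op V
  comp_right : ∀ {W : A} {V V' : B} (b : V ⟶ V') (g : V' ⟶ τ.functor.obj W),
    right W V (b ≫ g) = right W V' g ∘ₗ ract E (op W) b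

variable {E : Aᵒᵖ ⥤ B ⥤ ModuleCat.{v} k} {J : Type v} [AddCommGroup J] [Module k J] (τ : A ≌ B)

/-- The second Auslander–Reiten formula follows from the first one. -/
noncomputable def ARFormula.ofLeft (hE : IsStableExt E.flip)
    (l : ∀ (W : A) (V : B), (τ.inverse.obj V ⟶ W) ≃ₗ[k] ((E.obj (op W)).obj V →ₗ[k] J))
    (left_comp : ∀ {W W' : A} {V : B} (f : τ.inverse.obj V ⟶ W) (c : W ⟶ W'),
      l W' V (f ≫ c) = l W V f ∘ₗ lact E c.op V)
    (left_map_comp : ∀ {W : A} {V V' : B} (b : V ⟶ V') (f : τ.inverse.obj V' ⟶ W),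
      l W V (τ.inverse.map b ≫ f) = l W V' f ∘ₗ ract E (op W) b) : ARFormula E J τ :=
  -- Nothing says that τ is k-linear, so the adjunction bijection is not visibly linear. Acting on
  -- the image of the counit gives a map that is linear by construction; `hr'` identifies it with
  -- the adjunction bijection followed by `l`.
  let r : ∀ (W : A) (V : B), (V ⟶ τ.functor.obj W) →ₗ[k] ((E.obj (op W)).obj V →ₗ[k] J) :=
    fun W V => hE.orbitDual (X := op W) (l W (τ.functor.obj W) (τ.unitInv.app W)) V
  have hr : ∀ (W : A) (V : B) (g : V ⟶ τ.functor.obj W),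
      r W V g = l W V (τ.inverse.map g ≫ τ.unitInv.app W) := fun W V g => (left_map_comp g _).symm
  have hr' : ∀ (W : A) (V : B), ⇑(r W V) =
      (l W V).toEquiv ∘ (τ.symm.toAdjunction.homEquiv V W).symm := fun W V => funext fun g => by
    rw [hr, Function.comp_apply, Adjunction.homEquiv_counit]
    rfl
  { left := l
    left_comp := left_comp
    left_map_comp := left_map_comp
    right := fun W V => LinearEquiv.ofBijective (r W V) (by
      rw [hr']
      exact (Equiv.bijective _).comp (Equiv.bijective _))
    right_comp_map := fun {W W' V} g c => by
      change r W' V (g ≫ τ.functor.map c) = r W V g ∘ₗ lact E c.op V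
      rw [hr, hr, ← left_comp, Functor.map_comp, Category.assoc, Category.assoc]
      congr 2
      exact τ.unitInv.naturality c
    comp_right := fun {W V V'} b g => LinearMap.ext fun e =>
      congrArg (l W _ (τ.unitInv.app W)) (ract_comp E (op W) b g e) }

/-- The first Auslander–Reiten formula follows from the second one. -/
noncomputable def ARFormula.ofRight (hE : IsStableExt E)
    (r : ∀ (W : A) (V : B), (V ⟶ τ.functor.obj W) ≃ₗ[k] ((E.obj (op W)).obj V →ₗ[k] J))
    (right_comp_map : ∀ {W W' : A} {V : B} (g : V ⟶ τ.functor.obj W) (c : W ⟶ W'),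
      r W' V (g ≫ τ.functor.map c) = r W V g ∘ₗ lact E c.op V)
    (comp_right : ∀ {W : A} {V V' : B} (b : V ⟶ V') (g : V' ⟶ τ.functor.obj W),
      r W V (b ≫ g) = r W V' g ∘ₗ ract E (op W) b) : ARFormula E J τ :=
  let l : ∀ (W : A) (V : B), (τ.inverse.obj V ⟶ W) →ₗ[k] ((E.obj (op W)).obj V →ₗ[k] J) :=
    fun W V => hE.orbitDual (X := V) (r (τ.inverse.obj V) V (τ.counitInv.app V)) (op W) ∘ₗ
      (unopLinearEquiv (op W) (op (τ.inverse.obj V))).symm.toLinearMap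
  have hl : ∀ (W : A) (V : B) (f : τ.inverse.obj V ⟶ W),
      l W V f = r W V (τ.counitInv.app V ≫ τ.functor.map f) :=
    fun W V f => (right_comp_map _ f).symm
  have hl' : ∀ (W : A) (V : B), ⇑(l W V) =
      (r W V).toEquiv ∘ (τ.symm.toAdjunction.homEquiv V W) := fun W V => funext fun g => by
    rw [hl, Function.comp_apply, Adjunction.homEquiv_unit]
    rfl
  { right := r
    right_comp_map := right_comp_map
    comp_right := comp_right
    left := fun W V => LinearEquiv.ofBijective (l W V) (by
      rw [hl']
      exact (Equiv.bijective _).comp (Equiv.bijective _))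
    left_map_comp := fun {W V V'} b f => by
      change l W V (τ.inverse.map b ≫ f) = l W V' f ∘ₗ ract E (op W) b
      rw [hl, hl, ← comp_right, Functor.map_comp, ← Category.assoc, ← Category.assoc]
      congr 2
      exact (τ.counitInv.naturality b).symm
    left_comp := fun {W W' V} f c => LinearMap.ext fun e =>
      congrArg (r _ V (τ.counitInv.app V)) (lact_comp E c.op f.op V e) }

end

/-! ### The translate τ and the duality of the defects -/

namespace Extriangulated

variable {k : Type w} [CommRing k] {C : Type u} [Category.{v} C] [Preadditive C]
  [Linear k C] [HasBinaryBiproducts C] [HasZeroObject C] (T : Extriangulated k C)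
  {J : Type v} [AddCommGroup J] [Module k J]

theorem exists_arFormula [IsArtinianRing k] (hJ : IsInjectiveEnvelopeOfTop k J)
    (hproj : T.EnoughProjectives) (hinj : T.EnoughInjectives)
    (hidemP : IsIdempotentComplete T.ModProj) (hidemI : IsIdempotentComplete T.ModInj)
    (hdual : IsDualizingVariety k T.ModProj J ∨ IsDualizingVariety k T.ModInj J) :
    ∃ τ : T.ModProj ≌ T.ModInj, Nonempty (ARFormula T.stableExt J τ) := by
  have hE := T.isStableExt_stableExt hproj hinj
  have hE' := T.isStableExt_stableExt_flip hproj hinj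
  rcases hdual with hd | hd
  · have hfin : ∀ X Y : T.ModProjᵒᵖ, Module.Finite k (X ⟶ Y) := fun X Y =>
      have := hd.homFinite Y.unop X.unop
      Module.Finite.equiv (unopLinearEquiv X Y).symm
    obtain ⟨σ, hσ, ⟨θ⟩⟩ := hE.exists_equivalence hJ hfin (hd.isDualizingFor_op hE)
    -- Here σ : (C/[ℐ])ᵒᵖ → (C/[𝒫])ᵒᵖ is the opposite of τ⁻¹, so its representability isomorphism is
    -- the first formula. In the other case σ is τ itself, up to a double opposite, and gives the
    -- second.
    let τ : T.ModProj ≌ T.ModInj := σ.asEquivalence.unop.symm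
    refine ⟨τ, ⟨ARFormula.ofLeft τ hE'
      (fun W V => (unopLinearEquiv (op W) (σ.obj (op V))).symm ≪≫ₗ
        ((θ.app (op V)).app (op (op W))).toLinearEquiv) ?_ ?_⟩⟩
    · intro W W' V f c
      exact LinearMap.congr_fun (congrArg ModuleCat.Hom.hom
        ((θ.hom.app (op V)).naturality c.op.op)) f.op
    · intro W V V' b f
      exact LinearMap.congr_fun (congrArg ModuleCat.Hom.hom
        (NatTrans.congr_app (θ.hom.naturality b.op) (op (op W)))) f.op
  · obtain ⟨σ, hσ, ⟨θ⟩⟩ := hE'.exists_equivalence hJ hd.homFinite (hd.isDualizingFor hE')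
    let τ : T.ModProj ≌ T.ModInj := (opOpEquivalence T.ModProj).symm.trans σ.asEquivalence
    refine ⟨τ, ⟨ARFormula.ofRight τ hE
      (fun W V => ((θ.app (op (op W))).app (op V)).toLinearEquiv) ?_ ?_⟩⟩
    · intro W W' V g c
      exact LinearMap.congr_fun (congrArg ModuleCat.Hom.hom
        (NatTrans.congr_app (θ.hom.naturality c.op.op) (op V))) g
    · intro W V V' b g
      exact LinearMap.congr_fun (congrArg ModuleCat.Hom.hom
        ((θ.hom.app (op (op W))).naturality b.op)) g

variable {T} {τ : T.ModProj ≌ T.ModInj} (F : ARFormula T.stableExt J τ)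

include F

theorem nonempty_dualExtTo_iso : Nonempty (T.dualExtTo J ≅
    T.toModInj.op ⋙ τ.inverse.op ⋙ linearCoyoneda k T.ModProj ⋙
      (Functor.whiskeringLeft C T.ModProj (ModuleCat.{v} k)).obj T.toModProj) := by
  refine ⟨(NatIso.ofComponents (fun X => NatIso.ofComponents (fun Y =>
    (F.left (T.toModProj.obj Y) (T.toModInj.obj X.unop)).toModuleIso) ?_) ?_).symm⟩
  · intro Y Y' f
    exact ModuleCat.hom_ext (LinearMap.ext fun h => F.left_comp h (T.toModProj.map f))
  · intro X X' f
    exact NatTrans.ext (funext fun Y => ModuleCat.hom_ext (LinearMap.ext fun h =>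
      F.left_map_comp (T.toModInj.map f.unop) h))

theorem nonempty_dualExtFrom_iso : Nonempty (T.dualExtFrom J ≅
    T.toModProj ⋙ τ.functor ⋙ linearYoneda k T.ModInj ⋙
      (Functor.whiskeringLeft Cᵒᵖ T.ModInjᵒᵖ (ModuleCat.{v} k)).obj T.toModInj.op) := by
  refine ⟨(NatIso.ofComponents (fun X => NatIso.ofComponents (fun Y =>
    (F.right (T.toModProj.obj X) (T.toModInj.obj Y.unop)).toModuleIso) ?_) ?_).symm⟩
  · intro Y Y' f
    exact ModuleCat.hom_ext (LinearMap.ext fun h => F.comp_right (T.toModInj.map f.unop) h)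
  · intro X X' f
    exact NatTrans.ext (funext fun Y => ModuleCat.hom_ext (LinearMap.ext fun h =>
      F.right_comp_map h (T.toModProj.map f)))

variable [Module.Injective k J] (t : T.Triangle)

/-- Both sides are quotients of C/[𝒫](τ⁻¹-, X₃): one by restricting functionals from E(X₃, -) to
δ_*, the other by the defining presentation of δ^*. It remains to compare kernels. -/
theorem nonempty_dual_covDefect_iso :
    Nonempty (dualOfLeft J t.covDefectModInj ≅ τ.inverse.op ⋙ t.contraDefectModProj) := by
  let H : T.ModInjᵒᵖ ⥤ ModuleCat.{v} k :=
    τ.inverse.op ⋙ (linearYoneda k T.ModProj).obj (T.toModProj.obj t.X₃)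
  let p : H ⟶ dualOfLeft J t.covDefectModInj :=
    { app := fun V => ModuleCat.ofHom (LinearMap.lcomp k J (t.covIncl.app V.unop).hom ∘ₗ
        (F.left (T.toModProj.obj t.X₃) V.unop).toLinearMap)
      naturality := fun V W f => by
        refine ModuleCat.hom_ext (LinearMap.ext fun h => LinearMap.ext fun z => ?_)
        refine (LinearMap.congr_fun (F.left_map_comp f.unop h) _).trans ?_
        exact congrArg (F.left (T.toModProj.obj t.X₃) V.unop h)
          (LinearMap.congr_fun (congrArg ModuleCat.Hom.hom (t.covIncl.naturality f.unop)) z).symm }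
  refine nonempty_iso_of_surjective p (Functor.whiskerLeft τ.inverse.op t.contraProj) ?_
    (fun V => t.contraProj_surjective _) fun V h => Iff.trans ?_ (t.contraProj_eq_zero_iff h).symm
  · intro V ψ
    obtain ⟨φ, hφ⟩ := Module.Injective.exists_extension _ (t.covIncl_injective V.unop) ψ
    refine ⟨(F.left _ V.unop).symm φ, Eq.trans ?_ hφ⟩
    exact congrArg (fun χ => χ ∘ₗ (t.covIncl.app V.unop).hom) (LinearEquiv.apply_symm_apply _ φ)
  · constructor
    · intro hh
      -- A functional that vanishes on δ_*, the kernel of E(X₃, -) → E(X₂, -), factors through that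
      -- map; this translates into a factorization of h through f₂.
      obtain ⟨χ, hχ⟩ := Module.Injective.exists_factor
        (lact T.stableExt (T.toModProj.map t.f₂).op V.unop) (F.left _ V.unop h) fun e he => by
          obtain ⟨z, rfl⟩ := (t.exists_covIncl_eq_iff e).2 he
          exact LinearMap.congr_fun hh z
      refine ⟨(F.left _ V.unop).symm χ, (F.left _ V.unop).injective ?_⟩
      rw [F.left_comp, LinearEquiv.apply_symm_apply, hχ]
    · rintro ⟨g, rfl⟩
      refine LinearMap.ext fun z => ?_
      refine (LinearMap.congr_fun (F.left_comp g (T.toModProj.map t.f₂)) _).trans ?_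
      exact (congrArg _ ((t.exists_covIncl_eq_iff _).1 ⟨z, rfl⟩)).trans
        (map_zero (F.left (T.toModProj.obj t.X₂) V.unop g))

theorem nonempty_dual_contraDefect_iso :
    Nonempty (dualOfRight J t.contraDefectModProj ≅ τ.functor ⋙ t.covDefectModInj) := by
  let H : T.ModProj ⥤ ModuleCat.{v} k :=
    τ.functor ⋙ (linearCoyoneda k T.ModInj).obj (op (T.toModInj.obj t.X₁))
  let p : H ⟶ dualOfRight J t.contraDefectModProj :=
    { app := fun V => ModuleCat.ofHom (LinearMap.lcomp k J (t.contraIncl.app (op V)).hom ∘ₗ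
        (F.right V (T.toModInj.obj t.X₁)).toLinearMap)
      naturality := fun V W f => by
        refine ModuleCat.hom_ext (LinearMap.ext fun h => LinearMap.ext fun z => ?_)
        refine (LinearMap.congr_fun (F.right_comp_map h f) _).trans ?_
        exact congrArg (F.right V (T.toModInj.obj t.X₁) h)
          (LinearMap.congr_fun (congrArg ModuleCat.Hom.hom (t.contraIncl.naturality f.op)) z).symm }
  refine nonempty_iso_of_surjective p (Functor.whiskerLeft τ.functor t.covProj) ?_
    (fun V => t.covProj_surjective _) fun V h => Iff.trans ?_ (t.covProj_eq_zero_iff h).symm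
  · intro V ψ
    obtain ⟨φ, hφ⟩ := Module.Injective.exists_extension _ (t.contraIncl_injective (op V)) ψ
    refine ⟨(F.right V _).symm φ, Eq.trans ?_ hφ⟩
    exact congrArg (fun χ => χ ∘ₗ (t.contraIncl.app (op V)).hom)
      (LinearEquiv.apply_symm_apply _ φ)
  · constructor
    · intro hh
      obtain ⟨χ, hχ⟩ := Module.Injective.exists_factor
        (ract T.stableExt (op V) (T.toModInj.map t.f₁)) (F.right V _ h) fun e he => by
          obtain ⟨z, rfl⟩ := (t.exists_contraIncl_eq_iff e).2 he
          exact LinearMap.congr_fun hh z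
      refine ⟨(F.right V _).symm χ, (F.right V _).injective ?_⟩
      rw [F.comp_right, LinearEquiv.apply_symm_apply, hχ]
    · rintro ⟨g, rfl⟩
      refine LinearMap.ext fun z => ?_
      refine (LinearMap.congr_fun (F.comp_right (T.toModInj.map t.f₁) g) _).trans ?_
      exact (congrArg _ ((t.exists_contraIncl_eq_iff _).1 ⟨z, rfl⟩)).trans
        (map_zero (F.right V (T.toModInj.obj t.X₂) g))

end Extriangulated

end ARDuality

theorem mainTheorem8 {k : Type w} [CommRing k] [IsArtinianRing k]
    {J : Type v} [AddCommGroup J] [Module k J] (hJ : IsInjectiveEnvelopeOfTop k J)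
    {C : Type u} [Category.{v} C] [Preadditive C] [Linear k C] [HasZeroObject C]
    [HasBinaryBiproducts C]
    (T : Extriangulated k C) (hExt : T.IsExtFinite)
    (hproj : T.EnoughProjectives) (hinj : T.EnoughInjectives)
    (hidemP : IsIdempotentComplete T.ModProj) (hidemI : IsIdempotentComplete T.ModInj)
    (hdual : IsDualizingVariety k T.ModProj J ∨ IsDualizingVariety k T.ModInj J) :
    ∃ τ : T.ModProj ≌ T.ModInj,
      -- `D E(-, X) ≅ C/[𝒫](τ⁻¹ X, -)`, naturally in both variables
      Nonempty (T.dualExtTo J ≅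
        T.toModInj.op ⋙ τ.inverse.op ⋙ linearCoyoneda k T.ModProj ⋙
          (Functor.whiskeringLeft C T.ModProj (ModuleCat.{v} k)).obj T.toModProj) ∧
      -- `D E(X, -) ≅ C/[ℐ](-, τ X)`, naturally in both variables
      Nonempty (T.dualExtFrom J ≅
        T.toModProj ⋙ τ.functor ⋙ linearYoneda k T.ModInj ⋙
          (Functor.whiskeringLeft Cᵒᵖ T.ModInjᵒᵖ (ModuleCat.{v} k)).obj T.toModInj.op) ∧
      -- `D δ_* ≅ δ^* τ⁻¹` and `D δ^* ≅ δ_* τ`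
      ∀ t : T.Triangle,
        Nonempty (dualOfLeft J t.covDefectModInj ≅ τ.inverse.op ⋙ t.contraDefectModProj) ∧
        Nonempty (dualOfRight J t.contraDefectModProj ≅ τ.functor ⋙ t.covDefectModInj) := by
  have := hJ.injective
  obtain ⟨τ, ⟨F⟩⟩ := T.exists_arFormula hJ hproj hinj hidemP hidemI hdual
  exact ⟨τ, Extriangulated.nonempty_dualExtTo_iso F, Extriangulated.nonempty_dualExtFrom_iso F,
    fun t => ⟨Extriangulated.nonempty_dual_covDefect_iso F t,
      Extriangulated.nonempty_dual_contraDefect_iso F t⟩⟩
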